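/- Let $K$ be a field of characteristic $0$ (more generally, a commutative $\mathbb{Q}$-algebra), $H$ a free $K$-module with finite basis $\{\phi_\alpha\}$ containing a distinguished element $\phi_1=\mathbf 1$, and $(\cdot,\cdot)$ a symmetric non-degenerate bilinear form on $H$, $g_{\alpha\beta}=(\phi_\alpha,\phi_\beta)$, $(g^{\alpha\beta})=(g_{\alpha\beta})^{-1}$. Let $\mathcal F(t_0,t_1,\dots)$, $t_k=\sum_\alpha t_k^\alpha\phi_\alpha$, be a formal power series over $K$ which satisfies, with $\partial_{\alpha,k}=\partial/\partial t_k^\alpha$, $$\text{(DE)}\quad \partial_{1,1}\mathcal F=\sum_{n,\nu}t_n^\nu\partial_{\nu,n}\mathcal F-2\mathcal F,\qquad \text{(SE)}\quad \partial_{1,0}\mathcal F=\tfrac12(t_0,t_0)+\sum_{n,\nu}t_{n+1}^\nu\partial_{\nu,n}\mathcal F,$$ $$\text{(TRR)}\quad \partial_{\alpha,k+1}\partial_{\beta,l}\partial_{\gamma,m}\mathcal F=\sum_{\mu,\nu}\partial_{\alpha,k}\partial_{\mu,0}\mathcal F\; g^{\mu\nu}\;\partial_{\nu,0}\partial_{\beta,l}\partial_{\gamma,m}\mathcal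 F\qquad(\text{all }\alpha,\beta,\gamma;\ k,l,m\ge 0).$$ On $\mathcal H=H((z^{-1}))$ put $\Omega(\mathbf f,\mathbf h)=\frac1{2\pi i}\oint(\mathbf f(-z),\mathbf h(z))\,dz$ (the coefficient of $z^{-1}$), and use $\mathcal H=H[z]\oplus z^{-1}H[[z^{-1}]]=\mathcal H_+\oplus\mathcal H_-$ to identify $\mathcal H$ with $T^*\mathcal H_+$: a point $\mathbf f$ is a pair $(\mathbf p,\mathbf q)$ where $\mathbf q$ is its $\mathcal H_+$-component and $\mathbf p$ is the covector $v\mapsto\Omega(\mathbf f,v)$ on $\mathcal H_+$. Write $\mathbf q(z)=-\mathbf 1 z+\sum_k t_kz^k$, and let $\mathcal L=\{\mathbf p=d_{\mathbf q}\mathcal F\}$, a formal germ at $\mathbf q=-z$. Its points, and those of the germs below, are families depending formally on parameters, that is, points with coordinates in rings $K[[x]]$ such that $t=0$ at $x=0$; likewise $\tau\in H$ is a formal parameter vanishing at $x=0$. The calibration corresponding to $\mathcal L$ is the $\operatorname{End}(H)$-valued series $S(z,\tau)=\mathbf 1+S_1(\tau)z^{-1}+S_2(\tau)z^{-2}+\cdots$,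 with coefficients formal in $\tau$, such that $S^*(-z)S(z)=\mathbf 1$ (where $^*$ is the adjoint with respect to $(\cdot,\cdot)$), $z\,\partial S/\partial\tau^\lambda=\phi_\lambda\bullet S$ for all $\lambda$, where $\phi_\lambda\bullet\phi_\delta=\sum_{\mu,\nu} g^{\mu\nu}\,(\partial_{\nu,0}\partial_{\lambda,0}\partial_{\delta,0}\mathcal F)(\tau,0,0,\dots)\,\phi_\mu$, and such that $J(z,\tau)=zS^*(z,\tau)\mathbf 1$ is the $J$-function of $\mathcal L$: $J(-z,\tau)$ is the point of $\mathcal L$ with $\mathcal H_+$-component $-z+\tau$. Put $\mathcal L_\tau=S(\tau)\mathcal L$. The ancestor potential $\bar{\mathcal F}_\tau(\bar t_0,\bar t_1,\dots)$, a formal power series in $\tau$ and $\bar{\mathbf t}=(\bar t_0,\bar t_1,\dots)$, is the generating function of $\mathcal L_\tau$: with $\mathbf q=-z+\sum_k\bar t_kz^k$, $\mathcal L_\tau$ is the graph $\mathbf p=d_{\mathbf q}\bar{\mathcal F}_\tau$, and $\bar{\mathcal F}_\tau$ is the restriction of the quadratic form $\mathbf p(\mathbf q)/2$ to $\mathcal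 L_\tau$. **Proposition.** The calibration $S$ exists and is unique, the ancestor potential $\bar{\mathcal F}_\tau$ exists and is unique, and $\bar{\mathcal F}_\tau$ is tame: for all $r\ge 0$ and all $(\alpha_1,k_1),\dots,(\alpha_r,k_r)$, $$\frac{\partial}{\partial\bar t^{\alpha_1}_{k_1}}\cdots\frac{\partial}{\partial\bar t^{\alpha_r}_{k_r}}\bar{\mathcal F}_\tau\Big|_{\bar{\mathbf t}=0}=0\quad\text{identically in }\tau\text{, whenever } k_1+\dots+k_r>r-3 .$$ -/

import Mathlib

/-!
Genus zero axiomatic theory over a commutative `ℚ`-algebra `K` (for instance the field of complex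
numbers, or a Novikov ring).

`H` is the free `K`-module with basis `φ_α`, `α : ι`; `g α β = (φ_α, φ_β)` is the Gram matrix of the
symmetric non-degenerate form; `φ_{i₀}` is the distinguished element `1` of `H`.
The index `(α, k) : ι × ℕ` stands for the coordinate `t_k^α`, so a formal function of
`t = (t_0, t_1, …)` is an element of `MvPowerSeries (ι × ℕ) K`.

Formal geometry: points of formal germs are taken with values in power series rings
`MvPowerSeries X K`, that is, they are families of points which depend formally on parameters
`x ∈ X` and specialise at `x = 0` to the base point of the germ.
-/

universe u v

noncomputable section

namespace GenusZero

open MvPowerSeries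

/-! ### Axioms -/

/-- Coefficientwise sum of a locally finite family of power series (every monomial occurs
in only finitely many members of each family to which this is applied). -/
def formalSum {I σ R : Type*} [CommRing R] (f : I → MvPowerSeries σ R) : MvPowerSeries σ R :=
  fun d => ∑ᶠ i, coeff d (f i)

section Axioms

variable {ι : Type u} [Fintype ι] [DecidableEq ι] {K : Type v} [CommRing K] [Algebra ℚ K]

/-- The Dilaton Equation: `∂_{1,1} F = ∑ t_n^ν ∂_{ν,n} F - 2 F`. -/
def DilatonEquation (i₀ : ι) (F : MvPowerSeries (ι × ℕ) K) : Prop :=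
  pderiv K (i₀, 1) F
    = formalSum (fun i : ι × ℕ => (X i : MvPowerSeries (ι × ℕ) K) * pderiv K i F) - (2 : ℚ) • F

/-- The String Equation: `∂_{1,0} F = (t_0, t_0) / 2 + ∑ t_{n+1}^ν ∂_{ν,n} F`. -/
def StringEquation (g : Matrix ι ι K) (i₀ : ι) (F : MvPowerSeries (ι × ℕ) K) : Prop :=
  pderiv K (i₀, 0) F
    = (1 / 2 : ℚ) • (∑ α, ∑ β, g α β • ((X (α, 0) : MvPowerSeries (ι × ℕ) K) * X (β, 0)))
      + formalSum (fun i : ι × ℕ =>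
          (X (i.1, i.2 + 1) : MvPowerSeries (ι × ℕ) K) * pderiv K i F)

/-- The Topological Recursion Relations. -/
def TopologicalRecursion (g : Matrix ι ι K) (F : MvPowerSeries (ι × ℕ) K) : Prop :=
  ∀ (α β γ : ι) (k l m : ℕ),
    pderiv K (α, k + 1) (pderiv K (β, l) (pderiv K (γ, m) F))
      = ∑ μ, ∑ ν, g⁻¹ μ ν • (pderiv K (α, k) (pderiv K (μ, 0) F)
          * pderiv K (ν, 0) (pderiv K (β, l) (pderiv K (γ, m) F)))

end Axioms

/-! ### The loop space and its symplectic form -/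

/-- `H((z⁻¹))` with scalars `R`: the coordinates in the basis `φ_α` are Laurent series in
the variable `w = z⁻¹`. -/
abbrev Loop (ι R : Type*) [CommRing R] : Type _ := ι → LaurentSeries R

section Loop

variable {ι : Type u} [Fintype ι] [DecidableEq ι] {K : Type v} [CommRing K]
  {R : Type*} [CommRing R] [Algebra K R]

/-- The coefficient of `z ^ n φ_α`. -/
def zCoeff (f : Loop ι R) (n : ℤ) (α : ι) : R := (f α).coeff (-n)

/-- The substitution `z ↦ -z` in a Laurent series in `z⁻¹`. -/
def negSeries (f : LaurentSeries R) : LaurentSeries R where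
  coeff n := (-1 : R) ^ n.natAbs * f.coeff n
  isPWO_support' := f.isPWO_support.mono (by
    intro n hn h
    exact hn (by simp [h]))

/-- The loop `f(-z)`. -/
def negLoop (f : Loop ι R) : Loop ι R := fun α => negSeries (f α)

/-- `Ω(f, h) = (1 / 2πi) ∮ (f(-z), h(z)) dz`, the coefficient of `z⁻¹ = w` in `(f(-z), h(z))`. -/
def Omega (g : Matrix ι ι K) (f h : Loop ι R) : R :=
  ∑ α, ∑ β, algebraMap K R (g α β) * (negLoop f α * h β).coeff 1

/-- The element `φ_α z ^ k` of `H_+ = H[z]`. -/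
def zMonomial (α : ι) (k : ℕ) : Loop ι R :=
  Pi.single α (HahnSeries.single (-(k : ℤ)) (1 : R))

/-- The dilaton shift `q(z) = -z + ∑ t_k z ^ k`, in coordinates. -/
def dilatonShift (i₀ : ι) (t : ι × ℕ →₀ R) : ι × ℕ →₀ R := t - Finsupp.single (i₀, 1) 1

/-- The `H_+`-component of `f` is `q(z) = -z + ∑ t_k z ^ k`. -/
def HasPosition (i₀ : ι) (f : Loop ι R) (t : ι × ℕ →₀ R) : Prop :=
  ∀ (α : ι) (k : ℕ), zCoeff f k α = dilatonShift i₀ t (α, k)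

/-- `f = (p, q)` in `T^*H_+` with `q = -z + ∑ t_k z ^ k` and with `p` the given covector;
the `H_-`-component of `f` is identified with the covector `v ↦ Ω(f, v)` on `H_+`. -/
def IsGraphPoint (g : Matrix ι ι K) (i₀ : ι) (f : Loop ι R) (t : ι × ℕ →₀ R)
    (p : ι × ℕ → R) : Prop :=
  HasPosition i₀ f t ∧ ∀ (α : ι) (k : ℕ), Omega g f (zMonomial α k) = p (α, k)

/-- The value `p(q)` of the covector `p` on the vector `q = -z + ∑ t_k z ^ k`, where `p` is
the `H_-`-component of `f`. -/
def pairingPQ (g : Matrix ι ι K) (i₀ : ι) (f : Loop ι R) (t : ι × ℕ →₀ R) : R :=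
  (dilatonShift i₀ t).sum fun i c => Omega g f (zMonomial i.1 i.2) * c

end Loop

/-! ### The Lagrangian cone and its calibration -/

/-- A family of scalars depending formally on parameters in `X` is infinitesimal if it vanishes at
the origin of the parameter space. -/
def Infinitesimal {I X K : Type*} [CommRing K] (t : I → MvPowerSeries X K) : Prop :=
  ∀ i, constantCoeff (t i) = 0

section Cone

variable {ι : Type u} [Fintype ι] [DecidableEq ι] {K : Type v} [CommRing K]

/-- The germ at `q = -z` of the graph `{(p, q) : p = d_q F}`: its points depending formally
on parameters in `Y`. -/
def cone (g : Matrix ι ι K) (i₀ : ι) (F : MvPowerSeries (ι × ℕ) K) (Y : Type u) :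
    Set (Loop ι (MvPowerSeries Y K)) :=
  {f | ∃ t : ι × ℕ →₀ MvPowerSeries Y K, Infinitesimal t ∧
    IsGraphPoint g i₀ f t (fun i => subst t (pderiv K i F))}

/-- The base point `t_0 = τ`, `t_1 = t_2 = … = 0`, with `τ` the universal formal parameter. -/
def smallPoint : ι × ℕ →₀ MvPowerSeries ι K :=
  ∑ α, Finsupp.single (α, 0) (X α)

/-- The restriction of `F` to `t_0 = τ`, `t_1 = t_2 = … = 0`. -/
def smallPhase (F : MvPowerSeries (ι × ℕ) K) : MvPowerSeries ι K :=
  subst smallPoint F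

/-- The matrix of `φ_l •` in the Frobenius structure:
`φ_l • φ_δ = ∑ g^{μν} ⟨φ_ν, φ_l, φ_δ⟩(τ) φ_μ`. -/
def quantumProduct (g : Matrix ι ι K) (F : MvPowerSeries (ι × ℕ) K) (l : ι) :
    Matrix ι ι (MvPowerSeries ι K) :=
  Matrix.of fun μ δ => ∑ ν, g⁻¹ μ ν •
    smallPhase (pderiv K (ν, 0) (pderiv K (l, 0) (pderiv K (δ, 0) F)))

/-- `J` is the `J`-function of the cone of `F`: the loop `J(-z, τ)` is the point of the cone
in `-z + τ + H_-`. -/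
def IsJFunction (g : Matrix ι ι K) (i₀ : ι) (F : MvPowerSeries (ι × ℕ) K)
    (J : Loop ι (MvPowerSeries ι K)) : Prop :=
  IsGraphPoint g i₀ (negLoop J) smallPoint (fun i => smallPhase (pderiv K i F))

/-- The adjoint `S^*` with respect to the bilinear form, `(S u, v) = (u, S^* v)`. -/
def adjoint {A : Type*} [CommRing A] [Algebra K A] (g : Matrix ι ι K) (S : Matrix ι ι A) :
    Matrix ι ι A :=
  g⁻¹.map (algebraMap K A) * S.transpose * g.map (algebraMap K A)

/-- `S(z, τ) = 1 + S_1(τ) z⁻¹ + S_2(τ) z⁻² + …` is the calibration corresponding to the cone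
of `F`. Entries are power series in `z⁻¹` whose coefficients are formal functions of `τ`. -/
structure IsCalibration (g : Matrix ι ι K) (i₀ : ι) (F : MvPowerSeries (ι × ℕ) K)
    (S : Matrix ι ι (PowerSeries (MvPowerSeries ι K))) : Prop where
  /-- the leading term is `1` -/
  leading : S.map (fun s => PowerSeries.coeff 0 s) = 1
  /-- `S^*(-z) S(z) = 1` -/
  symplectic : (adjoint g S).map PowerSeries.evalNegHom * S = 1
  /-- `z ∂_l S = φ_l • S` -/
  flat : ∀ (l : ι) (n : ℕ),
    S.map (fun s => pderiv K l (PowerSeries.coeff (n + 1) s))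
      = quantumProduct g F l * S.map (fun s => PowerSeries.coeff n s)
  /-- `J(z, τ) = z S^*(z, τ) 1` is the `J`-function of the cone -/
  jFunction : IsJFunction g i₀ F (fun α =>
    HahnSeries.single (-1) 1 * HahnSeries.ofPowerSeries ℤ _ (adjoint g S α i₀))

/-- The operator `S(z, τ)` on loops with scalars `MvPowerSeries Y K`, for a parameter `τ` in `H`
depending formally on `Y`. -/
def calibrationAt {Y : Type u} (S : Matrix ι ι (PowerSeries (MvPowerSeries ι K)))
    (τ : ι → MvPowerSeries Y K) : Matrix ι ι (LaurentSeries (MvPowerSeries Y K)) :=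
  S.map fun s => HahnSeries.ofPowerSeries ℤ _
    (PowerSeries.mk fun n => subst τ (PowerSeries.coeff n s))

/-- `L_τ = S(τ) L`. -/
def translatedCone (g : Matrix ι ι K) (i₀ : ι) (F : MvPowerSeries (ι × ℕ) K)
    (S : Matrix ι ι (PowerSeries (MvPowerSeries ι K))) {Y : Type u}
    (τ : ι → MvPowerSeries Y K) : Set (Loop ι (MvPowerSeries Y K)) :=
  (fun f => (calibrationAt S τ).mulVec f) '' cone g i₀ F Y

/-! ### Ancestor potentials -/

/-- For a formal function `G` of `(τ, t̄)` (a power series in variables `Sum.inl α` for `τ^α` and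
`Sum.inr (α, k)` for `t̄_k^α`), the germ at `q = -z` of the graph of the differential of `G(τ, ·)`. -/
def parametricGraph (g : Matrix ι ι K) (i₀ : ι) (G : MvPowerSeries (ι ⊕ ι × ℕ) K) {Y : Type u}
    (τ : ι → MvPowerSeries Y K) : Set (Loop ι (MvPowerSeries Y K)) :=
  {f | ∃ t : ι × ℕ →₀ MvPowerSeries Y K, Infinitesimal t ∧
    IsGraphPoint g i₀ f t (fun i => subst (Sum.elim τ t) (pderiv K (Sum.inr i) G))}

/-- `G(τ, t̄)` is the ancestor potential: for each formal `τ` it is the generating function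
of the Lagrangian cone `L_τ = S(τ) L`, normalised as the restriction of the
quadratic form `p(q) / 2` to `L_τ`. -/
structure IsAncestorPotential [Algebra ℚ K] (g : Matrix ι ι K) (i₀ : ι)
    (F : MvPowerSeries (ι × ℕ) K) (S : Matrix ι ι (PowerSeries (MvPowerSeries ι K)))
    (G : MvPowerSeries (ι ⊕ ι × ℕ) K) : Prop where
  graph : ∀ (Y : Type u) (τ : ι → MvPowerSeries Y K), Infinitesimal τ →
    translatedCone g i₀ F S τ = parametricGraph g i₀ G τ
  quadratic : ∀ (Y : Type u) (τ : ι → MvPowerSeries Y K), Infinitesimal τ →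
    ∀ f ∈ translatedCone g i₀ F S τ, ∀ t : ι × ℕ →₀ MvPowerSeries Y K, Infinitesimal t →
      HasPosition i₀ f t → subst (Sum.elim τ t) G = (1 / 2 : ℚ) • pairingPQ g i₀ f t

/-- The restriction of a formal function of `(τ, t̄)` to `t̄ = 0`. -/
def atOrigin (G : MvPowerSeries (ι ⊕ ι × ℕ) K) : MvPowerSeries ι K :=
  subst (Sum.elim (fun α => (X α : MvPowerSeries ι K)) fun _ : ι × ℕ => 0) G

/-- `∂^r G / ∂t̄_{k_1}^{α_1} … ∂t̄_{k_r}^{α_r}` vanishes at `t̄ = 0`, identically in `τ`, whenever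
`k_1 + … + k_r > r - 3`. -/
def IsTame (G : MvPowerSeries (ι ⊕ ι × ℕ) K) : Prop :=
  ∀ l : List (ι × ℕ), ((l.map Prod.snd).sum : ℤ) > (l.length : ℤ) - 3 →
    atOrigin (l.foldr (fun i G' => pderiv K (Sum.inr i) G') G) = 0

end Cone

end GenusZero

end

set_option linter.unusedSectionVars false

noncomputable section

namespace GenusZero

open MvPowerSeries

/-! ### Power series: derivatives, substitutions and limits -/

section PowerSeriesTools

variable {σ τ K : Type*} [CommRing K]

/-! Write W_{kl}(τ) for the matrix of second derivatives ∂_{α,k}∂_{β,l}F at t = (τ, 0, 0, …). The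
string equation differentiated twice, together with TRR in which one slot is (1,0), yields W_{k+1,l}
+ W_{k,l+1} = W_{k,0} g⁻¹ W_{0,l} (`hessianMatrix_succ_add`). The calibration is S_{n+1} = g⁻¹
W_{0,n}: telescoping the identity gives S^*(-z)S(z) = 1, TRR gives flatness, and the string equation
gives the J-function. It is unique because φ_l • 1 = φ_l: the adjoint of the flatness equation
applied to 1 reads S_n^* φ_l = ∂_l S_{n+1}^* 1, so J determines S.

Since S contains no positive powers of z, it acts on positions by the invertible linear map q ↦
[Sq]_+. As S_1 1 = τ, this map is affine in t, and t̄ = 0 corresponds to t = (τ, 0, 0, …). On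
covectors S acts by p ↦ p - W(τ)q followed by the inverse transpose of that map
(`omega_seriesMatrix_mulVec`). Hence L_τ is the graph of the differential of F̄(t̄) = F(t) -
W(τ)(q,q)/2. The dilaton equation says that F is homogeneous of degree 2 in q, whence F̄ = p̄(q̄)/2.

For tameness, the Hessian of F̄ is the pullback of ∂∂F(t) - W(τ), which vanishes at t̄ = 0; by
homogeneity the gradient and the value vanish there too. Subtracting W(τ) is also exactly what makes
F̄ satisfy TRR again (`ancestorThird_succ`). An induction on k_1 + … + k_r, in which TRR lowers one
index, then kills all the required derivatives (`isTame_of_recursion`).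

Formally, points have finitely many nonzero coordinates while F̄ depends on infinitely many
variables. So F̄ is computed at universal points, with t̄_k free for k < N, and glued; naturality
under substitution carries statements between these and arbitrary points. -/

theorem pderiv_comm (i j : σ) (f : MvPowerSeries σ K) :
    pderiv K i (pderiv K j f) = pderiv K j (pderiv K i f) := by
  classical
  ext d
  simp only [coeff_pderiv, Finsupp.add_apply, Finsupp.single_apply]
  rcases eq_or_ne i j with rfl | h
  · rfl
  · rw [add_right_comm]
    simp only [h, h.symm, if_false, Nat.cast_add, Nat.cast_zero]
    ring

open WithPiTopology in
theorem continuous_pderiv [TopologicalSpace K] [IsTopologicalRing K] (i : σ) :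
    Continuous (pderiv K i : MvPowerSeries σ K → MvPowerSeries σ K) := by
  refine continuous_pi fun d => ?_
  have : (fun f : MvPowerSeries σ K => pderiv K i f d)
      = fun f => coeff (d + Finsupp.single i 1) f * ((d i : K) + 1) := by
    funext f
    exact coeff_pderiv f d
  rw [this]
  exact (continuous_coeff K _).mul continuous_const

/-- The chain rule for a substitution of series only finitely many of which depend on `y`. -/
theorem pderiv_subst {a : σ → MvPowerSeries τ K} (ha : HasSubst a) (y : τ) (s : Finset σ)
    (hs : ∀ i ∉ s, pderiv K y (a i) = 0) (f : MvPowerSeries σ K) :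
    pderiv K y (subst a f) = ∑ i ∈ s, pderiv K y (a i) * subst a (pderiv K i f) := by
  classical
  -- For discrete K the polynomials are dense and both sides are continuous in `f`, so it suffices
  -- to check polynomials.
  let : UniformSpace K := ⊥
  have : DiscreteUniformity K := ⟨rfl⟩
  open WithPiTopology in
  have hc : Continuous (subst a : MvPowerSeries σ K → MvPowerSeries τ K) := continuous_subst ha
  open WithPiTopology in
  have key := (denseRange_toMvPowerSeries (σ := σ) (R := K)).equalizer
    (g := fun f => pderiv K y (subst a f))
    (h := fun f => ∑ i ∈ s, pderiv K y (a i) * subst a (pderiv K i f))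
    ((continuous_pderiv y).comp hc)
    (continuous_finsetSum _ fun i _ => continuous_const.mul (hc.comp (continuous_pderiv i)))
    (by
      funext p
      simp only [Function.comp_apply]
      induction p using MvPolynomial.induction_on with
      | C r =>
        have h1 : ((MvPolynomial.C r : MvPolynomial σ K) : MvPowerSeries σ K) = C r := by simp
        have h2 : subst a (C r : MvPowerSeries σ K) = C r := by
          rw [← MvPolynomial.coe_C, subst_coe]
          simp [MvPowerSeries.algebraMap_apply]
        have h3 : subst a (0 : MvPowerSeries σ K) = 0 := by
          rw [← substAlgHom_apply ha, map_zero]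
        rw [h1, h2]
        simp [h3]
      | add p q hp hq =>
        simp only [MvPolynomial.coe_add, subst_add ha, map_add, mul_add,
          Finset.sum_add_distrib] at hp hq ⊢
        rw [hp, hq]
      | mul_X p i hp =>
        have hX : subst a (pderiv K i (X i : MvPowerSeries σ K)) = 1 := by
          rw [pderiv_X_self, ← substAlgHom_apply ha, map_one]
        have hterm : ∀ j, subst a (pderiv K j ((p : MvPowerSeries σ K) * X i))
            = subst a (p : MvPowerSeries σ K) * (if j = i then 1 else 0)
              + a i * subst a (pderiv K j (p : MvPowerSeries σ K)) := by
          intro j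
          rw [Derivation.leibniz, subst_add ha]
          simp only [smul_eq_mul]
          rw [subst_mul ha, subst_mul ha, subst_X ha, pderiv_X]
          congr 2
          split_ifs with h
          · rw [h, Pi.single_eq_same, ← substAlgHom_apply ha, map_one]
          · rw [Pi.single_eq_of_ne (Ne.symm h), ← substAlgHom_apply ha, map_zero]
        rw [MvPolynomial.coe_mul, MvPolynomial.coe_X, subst_mul ha, subst_X ha,
          Derivation.leibniz, hp]
        simp only [hterm, smul_eq_mul, mul_add, Finset.sum_add_distrib, Finset.mul_sum]
        congr 1
        · by_cases h : i ∈ s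
          · rw [Finset.sum_eq_single_of_mem i h]
            · simp [mul_comm]
            · intro j _ hj
              simp [hj]
          · rw [hs i h, mul_zero, Finset.sum_eq_zero]
            intro j hj
            rw [if_neg (by rintro rfl; exact h hj)]
            simp
        · refine Finset.sum_congr rfl fun j _ => ?_
          ring)
  exact congrFun key f

theorem pderiv_subst_eq_zero {a : σ → MvPowerSeries τ K} (ha : HasSubst a) (y : τ)
    (hs : ∀ i, pderiv K y (a i) = 0) (f : MvPowerSeries σ K) :
    pderiv K y (subst a f) = 0 := by
  rw [pderiv_subst ha y ∅ fun i _ => hs i]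
  simp

/-- A locally finite family sums up to its formal sum under any continuous additive map. -/
theorem sum_eq_map_formalSum {M : Type*} [CommRing M] [UniformSpace K] [DiscreteUniformity K]
    [TopologicalSpace M] [T2Space M] {I : Type*} (φ : MvPowerSeries σ K →+ M)
    (hφ : open WithPiTopology in Continuous φ)
    (f : I → MvPowerSeries σ K) (hf : ∀ d, {i | coeff d (f i) ≠ 0}.Finite)
    (s : Finset I) (hs : ∀ i ∉ s, φ (f i) = 0) :
    φ (formalSum f) = ∑ i ∈ s, φ (f i) := by
  open WithPiTopology in
  have h : HasSum f (formalSum f) := by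
    rw [hasSum_iff_hasSum_coeff]
    intro d
    have : coeff d (formalSum f) = ∑ i ∈ (hf d).toFinset, coeff d (f i) := by
      rw [← finsum_eq_sum_of_support_subset]
      · rfl
      · intro i hi
        simpa using hi
    rw [this]
    refine hasSum_sum_of_ne_finset_zero fun i hi => ?_
    simpa using hi
  open WithPiTopology in
  exact (h.map φ hφ).unique (hasSum_sum_of_ne_finset_zero hs)

theorem finite_setOf_coeff_X_mul {I : Type*} {s : I → σ} (hs : Function.Injective s)
    (f : I → MvPowerSeries σ K) (d : σ →₀ ℕ) :
    {i | coeff d ((X (s i) : MvPowerSeries σ K) * f i) ≠ 0}.Finite := by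
  classical
  refine ((d.support.finite_toSet).preimage hs.injOn).subset fun i hi => ?_
  by_contra h
  apply hi
  rw [X, coeff_monomial_mul, if_neg]
  simpa [Finsupp.single_le_iff] using h

/-- Setting to zero the variables outside `p`. -/
def restrictVars (p : σ → Prop) [DecidablePred p] : MvPowerSeries σ K →+* MvPowerSeries σ K :=
  rescale fun i => if p i then 1 else 0

theorem coeff_restrictVars (p : σ → Prop) [DecidablePred p] (f : MvPowerSeries σ K)
    (d : σ →₀ ℕ) :
    coeff d (restrictVars p f) = if ∀ i ∈ d.support, p i then coeff d f else 0 := by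
  rw [restrictVars, coeff_rescale]
  split_ifs with h
  · rw [Finsupp.prod, Finset.prod_eq_one, one_mul]
    intro i hi
    rw [if_pos (h i hi), one_pow]
  · push Not at h
    obtain ⟨i, hi, hp⟩ := h
    rw [Finsupp.prod, Finset.prod_eq_zero hi, zero_mul]
    rw [if_neg hp, zero_pow (by simpa using hi)]

theorem hasSubst_restrict (p : σ → Prop) [DecidablePred p] :
    HasSubst (fun i => if p i then (X i : MvPowerSeries σ K) else 0) := by
  convert! HasSubst.smul_X (fun i : σ => if p i then (1 : K) else 0) using 1
  funext i
  by_cases h : p i <;> simp [h]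

theorem restrictVars_eq_subst (p : σ → Prop) [DecidablePred p] (f : MvPowerSeries σ K) :
    restrictVars p f = subst (fun i => if p i then (X i : MvPowerSeries σ K) else 0) f := by
  rw [restrictVars, rescale_eq_subst]
  congr 1
  funext i
  by_cases h : p i <;> simp [h]

theorem pderiv_restrictVars (p : σ → Prop) [DecidablePred p] {i : σ} (hi : p i)
    (f : MvPowerSeries σ K) :
    pderiv K i (restrictVars p f) = restrictVars p (pderiv K i f) := by
  classical
  ext d
  simp only [coeff_pderiv, coeff_restrictVars, Finsupp.mem_support_iff]
  have : (∀ j, (d + Finsupp.single i 1 : σ →₀ ℕ) j ≠ 0 → p j) ↔ ∀ j, d j ≠ 0 → p j := by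
    refine ⟨fun h j hj => h j (by simp [hj]), fun h j hj => ?_⟩
    by_cases hij : i = j
    · exact hij ▸ hi
    · exact h j (by simpa [Finsupp.single_apply, hij] using hj)
  simp only [this]
  split_ifs <;> simp

/-- Subset restrictions determine a power series. -/
theorem eq_of_restrictVars_eq {p : ℕ → σ → Prop} [∀ n, DecidablePred (p n)]
    (hp : ∀ d : σ →₀ ℕ, ∃ N, ∀ n ≥ N, ∀ i ∈ d.support, p n i) {f f' : MvPowerSeries σ K} (M : ℕ)
    (h : ∀ n ≥ M, restrictVars (p n) f = restrictVars (p n) f') : f = f' := by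
  ext d
  obtain ⟨N, hN⟩ := hp d
  have := congrArg (coeff d) (h (max M N) (le_max_left _ _))
  rwa [coeff_restrictVars, coeff_restrictVars, if_pos (hN _ (le_max_right _ _)),
    if_pos (hN _ (le_max_right _ _))] at this

/-- Compatible restrictions glue to a power series. -/
theorem exists_restrictVars_eq {p : ℕ → σ → Prop} [∀ n, DecidablePred (p n)]
    (hp : ∀ d : σ →₀ ℕ, ∃ N, ∀ n ≥ N, ∀ i ∈ d.support, p n i)
    (f : ℕ → MvPowerSeries σ K)
    (hf : ∀ m n, m ≤ n → restrictVars (p m) (f n) = f m) :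
    ∃ G, ∀ n, restrictVars (p n) G = f n := by
  choose N hN using hp
  -- The coefficient at `d` is read off at a stage from which all variables of `d` are allowed;
  -- compatibility makes the choice of stage irrelevant.
  let G : MvPowerSeries σ K := fun d => coeff d (f (N d))
  refine ⟨G, fun n => ?_⟩
  ext d
  rw [coeff_restrictVars]
  have key : ∀ a b, a ≤ b → (∀ i ∈ d.support, p a i) → coeff d (f a) = coeff d (f b) := by
    intro a b hab h
    rw [← hf a b hab, coeff_restrictVars, if_pos h]
  split_ifs with h
  · change coeff d (f (N d)) = _
    rcases le_total (N d) n with hn | hn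
    · exact key _ _ hn (hN d _ le_rfl)
    · exact (key _ _ hn h).symm
  · rw [← hf n n le_rfl, coeff_restrictVars, if_neg h]

end PowerSeriesTools

/-! ### Consequences of the axioms at infinitesimal points -/

section Points

variable {I X K : Type*} [CommRing K]

theorem hasSubst_of_finsupp {t : I →₀ MvPowerSeries X K} (ht : Infinitesimal t) :
    HasSubst (t : I → MvPowerSeries X K) where
  const_coeff s := by rw [ht s]; exact IsNilpotent.zero
  coeff_zero d := t.hasFiniteSupport.subset fun i hi h => hi (by rw [h]; simp)

theorem hasSubst_of_finite [Finite I] {t : I → MvPowerSeries X K} (ht : Infinitesimal t) :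
    HasSubst t :=
  hasSubst_of_constantCoeff_zero ht

end Points

section Axioms

open WithPiTopology

variable {ι : Type*} [Fintype ι] [DecidableEq ι] {K : Type*} [CommRing K]

omit [Fintype ι] in
theorem sum_dilatonShift {R : Type*} [CommRing R] (i₀ : ι) (t : ι × ℕ →₀ R)
    (f : ι × ℕ → R) :
    (dilatonShift i₀ t).sum (fun i c => c * f i) = t.sum (fun i c => c * f i) - f (i₀, 1) := by
  rw [dilatonShift, Finsupp.sum_sub_index (fun i a b => sub_mul a b (f i)),
    Finsupp.sum_single_index (zero_mul _), one_mul]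

variable [Algebra ℚ K] {i₀ : ι} {F : MvPowerSeries (ι × ℕ) K}

/-- The dilaton shift absorbs ∂_{1,1}F into the Euler field, so the dilaton equation becomes Euler's
identity: F has degree 2 in q. -/
theorem DilatonEquation.sum_mul_subst_pderiv (hDE : DilatonEquation i₀ F) {Y : Type*}
    {t : ι × ℕ →₀ MvPowerSeries Y K} (ht : Infinitesimal t) :
    (dilatonShift i₀ t).sum (fun i c => c * subst t (pderiv K i F)) = (2 : ℚ) • subst t F := by
  have hs := hasSubst_of_finsupp ht
  let : UniformSpace K := ⊥
  have : DiscreteUniformity K := ⟨rfl⟩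
  have h0 : ∀ f : MvPowerSeries (ι × ℕ) K, (substAlgHom hs : _ →ₐ[K] _).toRingHom.toAddMonoidHom f
      = subst t f := fun f => substAlgHom_apply hs f
  have hX : ∀ i, subst t ((X i : MvPowerSeries (ι × ℕ) K) * pderiv K i F)
      = t i * subst t (pderiv K i F) := fun i => by rw [subst_mul hs, subst_X hs]
  have h := sum_eq_map_formalSum (substAlgHom hs : _ →ₐ[K] _).toRingHom.toAddMonoidHom
    (by
      rw [show ⇑(substAlgHom hs : _ →ₐ[K] _).toRingHom.toAddMonoidHom
        = (subst t : MvPowerSeries (ι × ℕ) K → _) from funext h0]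
      exact continuous_subst hs)
    (fun i : ι × ℕ => (X i : MvPowerSeries (ι × ℕ) K) * pderiv K i F)
    (finite_setOf_coeff_X_mul Function.injective_id _) t.support
    (fun i hi => by rw [h0, hX, Finsupp.notMem_support_iff.mp hi, zero_mul])
  simp only [h0, hX] at h
  have h' := congrArg (subst (t : ι × ℕ → MvPowerSeries Y K)) hDE
  rw [subst_sub hs, h] at h'
  rw [sum_dilatonShift, h', Finsupp.sum, sub_sub_cancel, ← substAlgHom_apply (R := K) hs,
    ← substAlgHom_apply (R := K) hs, map_rat_smul]

/-- First derivatives of F have degree 1 in q, so the gradient is the Hessian applied to q. -/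
theorem DilatonEquation.sum_mul_subst_pderiv_pderiv (hDE : DilatonEquation i₀ F) {Y : Type*}
    {t : ι × ℕ →₀ MvPowerSeries Y K} (ht : Infinitesimal t) (j : ι × ℕ) :
    (dilatonShift i₀ t).sum (fun i c => c * subst t (pderiv K i (pderiv K j F)))
      = subst t (pderiv K j F) := by
  have hs := hasSubst_of_finsupp ht
  let : UniformSpace K := ⊥
  have : DiscreteUniformity K := ⟨rfl⟩
  let φ : MvPowerSeries (ι × ℕ) K →+ MvPowerSeries Y K :=
    (substAlgHom hs : _ →ₐ[K] _).toRingHom.toAddMonoidHom.comp (pderiv K j).toLinearMap.toAddMonoidHom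
  have h0 : ∀ f, φ f = subst t (pderiv K j f) := fun f => substAlgHom_apply hs _
  have hX : ∀ i, subst t (pderiv K j ((X i : MvPowerSeries (ι × ℕ) K) * pderiv K i F))
      = t i * subst t (pderiv K i (pderiv K j F))
        + if i = j then subst t (pderiv K i F) else 0 := fun i => by
    rw [Derivation.leibniz, subst_add hs, smul_eq_mul, smul_eq_mul, subst_mul hs, subst_mul hs,
      subst_X hs, pderiv_comm, pderiv_X]
    split_ifs with h
    · rw [h, Pi.single_eq_same, ← substAlgHom_apply (R := K) hs 1, map_one, mul_one]
    · rw [Pi.single_eq_of_ne h, ← substAlgHom_apply (R := K) hs 0, map_zero, mul_zero]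
  have h := sum_eq_map_formalSum φ
    (by
      rw [show ⇑φ = (subst t : MvPowerSeries (ι × ℕ) K → _) ∘ pderiv K j from funext h0]
      exact (continuous_subst hs).comp (continuous_pderiv j))
    (fun i : ι × ℕ => (X i : MvPowerSeries (ι × ℕ) K) * pderiv K i F)
    -- The derivative may fall on X_j itself, so the index `j` contributes even when t_j = 0.
    (finite_setOf_coeff_X_mul Function.injective_id _) (insert j t.support)
    (fun i hi => by
      rw [Finset.mem_insert, not_or] at hi
      rw [h0, hX, Finsupp.notMem_support_iff.mp hi.2, zero_mul, if_neg hi.1, add_zero])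
  simp only [h0, hX, Finset.sum_add_distrib] at h
  rw [Finset.sum_ite_eq' (insert j t.support), if_pos (Finset.mem_insert_self _ _),
    ← Finsupp.sum_of_support_subset t (Finset.subset_insert j _)
      (fun i c => c * subst t (pderiv K i (pderiv K j F))) (by simp)] at h
  have h' := congrArg (fun f => subst (t : ι × ℕ → MvPowerSeries Y K) (pderiv K j f)) hDE
  simp only [map_sub, subst_sub hs, h, pderiv_comm j] at h'
  rw [sum_dilatonShift, h', map_rat_smul, ← substAlgHom_apply (R := K) hs ((2 : ℚ) • _), map_rat_smul,
    substAlgHom_apply, two_smul]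
  abel

end Axioms

/-! ### The string equation on the small phase space -/

section SmallPhase

open WithPiTopology

variable {ι : Type*} [Fintype ι] {K : Type*} [CommRing K]

theorem smallPoint_zero (α : ι) : (smallPoint : ι × ℕ →₀ MvPowerSeries ι K) (α, 0) = X α := by
  classical
  simp [smallPoint, Finsupp.finsetSum_apply, Finsupp.single_apply, Finset.sum_ite_eq']

theorem smallPoint_succ (α : ι) (k : ℕ) :
    (smallPoint : ι × ℕ →₀ MvPowerSeries ι K) (α, k + 1) = 0 := by
  classical
  simp [smallPoint, Finsupp.finsetSum_apply]

theorem infinitesimal_smallPoint :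
    Infinitesimal (smallPoint : ι × ℕ →₀ MvPowerSeries ι K) := by
  rintro ⟨α, k⟩
  cases k with
  | zero => rw [smallPoint_zero, constantCoeff_X]
  | succ k => rw [smallPoint_succ, map_zero]

/-- Restriction to the small phase space as an algebra homomorphism. -/
def smallHom : MvPowerSeries (ι × ℕ) K →ₐ[K] MvPowerSeries ι K :=
  substAlgHom (hasSubst_of_finsupp infinitesimal_smallPoint)

theorem smallPhase_eq (f : MvPowerSeries (ι × ℕ) K) : smallPhase f = smallHom f :=
  (substAlgHom_apply _ f).symm

theorem smallHom_X_zero (α : ι) : smallHom (X (α, 0) : MvPowerSeries (ι × ℕ) K) = X α := by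
  rw [← smallPhase_eq, smallPhase, subst_X (hasSubst_of_finsupp infinitesimal_smallPoint),
    smallPoint_zero]

theorem smallHom_X_succ (α : ι) (k : ℕ) :
    smallHom (X (α, k + 1) : MvPowerSeries (ι × ℕ) K) = 0 := by
  rw [← smallPhase_eq, smallPhase, subst_X (hasSubst_of_finsupp infinitesimal_smallPoint),
    smallPoint_succ]

theorem pderiv_smallHom (α : ι) (f : MvPowerSeries (ι × ℕ) K) :
    pderiv K α (smallHom f) = smallHom (pderiv K (α, 0) f) := by
  classical
  rw [← smallPhase_eq, smallPhase,
    pderiv_subst (hasSubst_of_finsupp infinitesimal_smallPoint) α {(α, 0)}]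
  · rw [Finset.sum_singleton, smallPoint_zero, pderiv_X_self, one_mul, ← smallPhase_eq, smallPhase]
  · rintro ⟨β, k⟩ h
    cases k with
    | zero =>
      rw [smallPoint_zero, pderiv_X_of_ne]
      rintro rfl
      simp at h
    | succ k => rw [smallPoint_succ, map_zero]

variable [DecidableEq ι] [Algebra ℚ K] {g : Matrix ι ι K} {i₀ : ι} {F : MvPowerSeries (ι × ℕ) K}

/-- A common device for differentiating the string equation and restricting to t = (τ, 0, 0, …): any
continuous additive `φ` may be applied term by term, and for the maps used below only the indices in
a small finite set `s` survive. -/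
theorem StringEquation.smallHom_pderiv (hSE : StringEquation g i₀ F)
    (φ : MvPowerSeries (ι × ℕ) K →+ MvPowerSeries ι K)
    (hφ : ∀ [UniformSpace K] [DiscreteUniformity K], Continuous φ)
    (s : Finset (ι × ℕ)) (hs : ∀ i ∉ s, φ (X (i.1, i.2 + 1) * pderiv K i F) = 0) :
    φ (pderiv K (i₀, 0) F) = φ ((1 / 2 : ℚ) • (∑ α, ∑ β,
        g α β • ((X (α, 0) : MvPowerSeries (ι × ℕ) K) * X (β, 0))))
      + ∑ i ∈ s, φ (X (i.1, i.2 + 1) * pderiv K i F) := by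
  let : UniformSpace K := ⊥
  have : DiscreteUniformity K := ⟨rfl⟩
  rw [hSE, map_add, sum_eq_map_formalSum φ hφ _
    (finite_setOf_coeff_X_mul (s := fun i : ι × ℕ => (i.1, i.2 + 1)) ?_ _) s hs]
  rintro ⟨a, b⟩ ⟨c, d⟩ h
  simpa using h

theorem continuous_smallHom [UniformSpace K] [DiscreteUniformity K] :
    Continuous (smallHom : MvPowerSeries (ι × ℕ) K → MvPowerSeries ι K) := by
  have : (smallHom : MvPowerSeries (ι × ℕ) K → MvPowerSeries ι K) = subst smallPoint :=
    funext fun f => (smallPhase_eq f).symm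
  rw [this]
  exact continuous_subst (hasSubst_of_finsupp infinitesimal_smallPoint)

theorem pderiv_quadratic_zero (hsymm : g.IsSymm) (γ : ι) :
    pderiv K (γ, 0) ((1 / 2 : ℚ) • (∑ α, ∑ β,
        g α β • ((X (α, 0) : MvPowerSeries (ι × ℕ) K) * X (β, 0)))) =
      ∑ β, g γ β • X (β, 0) := by
  have h : ∀ α β, g α β • (X (α, 0) * (Pi.single (γ, 0) 1 : ι × ℕ → MvPowerSeries (ι × ℕ) K) (β, 0)
      + X (β, 0) * (Pi.single (γ, 0) 1 : ι × ℕ → MvPowerSeries (ι × ℕ) K) (α, 0))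
      = (if β = γ then g α β • X (α, 0) else 0) + (if α = γ then g α β • X (β, 0) else 0) := by
    intro α β
    simp [Pi.single_apply]
  simp only [map_rat_smul, map_sum, Derivation.map_smul, Derivation.leibniz, pderiv_X, smul_eq_mul,
    h, Finset.sum_add_distrib, Finset.sum_ite_eq', Finset.mem_univ, if_true]
  rw [Finset.sum_comm (f := fun α β => if α = γ then _ else _)]
  simp only [Finset.sum_ite_eq', Finset.mem_univ, if_true]
  rw [Finset.sum_congr rfl fun α _ => by rw [hsymm.apply γ α], ← two_smul ℚ, smul_smul]
  norm_num

theorem pderiv_quadratic_succ (γ : ι) (n : ℕ) :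
    pderiv K (γ, n + 1) ((1 / 2 : ℚ) • (∑ α, ∑ β,
        g α β • ((X (α, 0) : MvPowerSeries (ι × ℕ) K) * X (β, 0)))) = 0 := by
  simp [map_rat_smul, Derivation.leibniz]

/-- All t_{n+1} vanish on the small phase space, so only the quadratic term (t_0, t_0)/2
contributes. -/
theorem StringEquation.smallHom_pderiv_zero (hsymm : g.IsSymm) (hSE : StringEquation g i₀ F)
    (β : ι) :
    smallHom (pderiv K (i₀, 0) (pderiv K (β, 0) F)) = ∑ γ, g β γ • X γ := by
  have h := hSE.smallHom_pderiv
    ((smallHom : _ →ₐ[K] _).toRingHom.toAddMonoidHom.comp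
      (pderiv K (β, 0)).toLinearMap.toAddMonoidHom)
    (continuous_smallHom.comp (continuous_pderiv _)) ∅
    (fun i _ => by simp [Derivation.leibniz, smallHom_X_succ])
  simp only [AddMonoidHom.comp_apply, LinearMap.toAddMonoidHom_coe, Derivation.coeFn_coe,
    RingHom.toAddMonoidHom_eq_coe, AlgHom.toRingHom_eq_coe, AddMonoidHom.coe_coe,
    RingHom.coe_coe, pderiv_quadratic_zero hsymm, Finset.sum_empty, add_zero] at h
  rw [pderiv_comm, h]
  simp [smallHom_X_zero]

/-- The quadratic term does not involve t_{n+1}, and a term of the sum survives only if the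
derivative falls on its factor t_{n+1}^β. -/
theorem StringEquation.smallHom_pderiv_succ (hSE : StringEquation g i₀ F) (β : ι) (n : ℕ) :
    smallHom (pderiv K (i₀, 0) (pderiv K (β, n + 1) F)) = smallHom (pderiv K (β, n) F) := by
  have h := hSE.smallHom_pderiv
    ((smallHom : _ →ₐ[K] _).toRingHom.toAddMonoidHom.comp
      (pderiv K (β, n + 1)).toLinearMap.toAddMonoidHom)
    (continuous_smallHom.comp (continuous_pderiv _)) {(β, n)}
    (by
      rintro ⟨α, k⟩ hi
      have : ¬ (α = β ∧ k = n) := by simpa using hi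
      simp [Derivation.leibniz, smallHom_X_succ, this])
  simp only [AddMonoidHom.comp_apply, LinearMap.toAddMonoidHom_coe, Derivation.coeFn_coe,
    RingHom.toAddMonoidHom_eq_coe, AlgHom.toRingHom_eq_coe, AddMonoidHom.coe_coe,
    RingHom.coe_coe, pderiv_quadratic_succ, Finset.sum_singleton, map_zero, zero_add] at h
  rw [pderiv_comm, h]
  simp [Derivation.leibniz, smallHom_X_succ]

theorem StringEquation.smallHom_pderiv_succ_succ (hSE : StringEquation g i₀ F) (α β : ι)
    (k l : ℕ) :
    smallHom (pderiv K (i₀, 0) (pderiv K (α, k + 1) (pderiv K (β, l + 1) F)))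
      = smallHom (pderiv K (α, k + 1) (pderiv K (β, l) F))
        + smallHom (pderiv K (α, k) (pderiv K (β, l + 1) F)) := by
  have hterm : ∀ i : ι × ℕ, smallHom (pderiv K (α, k + 1) (pderiv K (β, l + 1)
      (X (i.1, i.2 + 1) * pderiv K i F)))
      = (if i = (β, l) then smallHom (pderiv K (α, k + 1) (pderiv K (β, l) F)) else 0)
        + (if i = (α, k) then smallHom (pderiv K (α, k) (pderiv K (β, l + 1) F)) else 0) := by
    rintro ⟨γ, m⟩
    have h1 : ∀ a b : ι × ℕ, pderiv K a ((Pi.single b 1 : ι × ℕ → MvPowerSeries (ι × ℕ) K)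
        (γ, m + 1)) = 0 := by
      intro a b
      by_cases h : (γ, m + 1) = b
      · rw [h, Pi.single_eq_same, Derivation.map_one_eq_zero]
      · rw [Pi.single_eq_of_ne h, map_zero]
    simp only [Derivation.leibniz, map_add, smul_eq_mul, pderiv_X, map_mul, h1, smallHom_X_succ,
      zero_mul, mul_zero, zero_add]
    rw [add_comm]
    congr 1
    · by_cases h2 : (γ, m) = (β, l)
      · obtain ⟨rfl, rfl⟩ := Prod.mk.inj h2
        rw [if_pos rfl, Pi.single_eq_same, map_one, one_mul]
      · rw [if_neg h2, Pi.single_eq_of_ne (by simpa using h2), map_zero, zero_mul]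
    · by_cases h2 : (γ, m) = (α, k)
      · obtain ⟨rfl, rfl⟩ := Prod.mk.inj h2
        rw [if_pos rfl, Pi.single_eq_same, map_one, mul_one, pderiv_comm]
      · rw [if_neg h2, Pi.single_eq_of_ne (by simpa using h2), map_zero, mul_zero]
  have h := hSE.smallHom_pderiv
    ((smallHom : _ →ₐ[K] _).toRingHom.toAddMonoidHom.comp
      ((pderiv K (α, k + 1)).toLinearMap.toAddMonoidHom.comp
        (pderiv K (β, l + 1)).toLinearMap.toAddMonoidHom))
    (continuous_smallHom.comp ((continuous_pderiv _).comp (continuous_pderiv _)))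
    -- If the two indices coincide this set has a single element, but `hterm` still counts both
    -- contributions.
    {(β, l), (α, k)}
    (by
      intro i hi
      simp only [Finset.mem_insert, Finset.mem_singleton, not_or] at hi
      have := hterm i
      rw [if_neg hi.1, if_neg hi.2, add_zero] at this
      exact this)
  simp only [AddMonoidHom.comp_apply, LinearMap.toAddMonoidHom_coe, Derivation.coeFn_coe,
    RingHom.toAddMonoidHom_eq_coe, AlgHom.toRingHom_eq_coe, AddMonoidHom.coe_coe,
    RingHom.coe_coe, pderiv_quadratic_succ, map_zero, zero_add, hterm,
    Finset.sum_add_distrib, Finset.sum_ite_eq', Finset.mem_insert, Finset.mem_singleton,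
    true_or, or_true, if_true] at h
  rw [pderiv_comm (i₀, 0), pderiv_comm (i₀, 0), h]

end SmallPhase

/-! ### Matrices of power series -/

section Matrices

variable {ι K : Type*} [Fintype ι] [DecidableEq ι] [CommRing K]

/-- The matrix of `n`-th coefficients. -/
def coeffMatrix {A : Type*} [CommRing A] (n : ℕ) (M : Matrix ι ι (PowerSeries A)) :
    Matrix ι ι A :=
  M.map fun s => PowerSeries.coeff n s

theorem ext_coeffMatrix {A : Type*} [CommRing A] {M N : Matrix ι ι (PowerSeries A)}
    (h : ∀ n, coeffMatrix n M = coeffMatrix n N) : M = N := by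
  ext α β n
  exact congrFun (congrFun (h n) α) β

theorem coeffMatrix_mul {A : Type*} [CommRing A] (n : ℕ) (M N : Matrix ι ι (PowerSeries A)) :
    coeffMatrix n (M * N)
      = ∑ p ∈ Finset.HasAntidiagonal.antidiagonal n, coeffMatrix p.1 M * coeffMatrix p.2 N := by
  ext α β
  simp only [coeffMatrix, Matrix.map_apply, Matrix.mul_apply, map_sum, PowerSeries.coeff_mul,
    Matrix.sum_apply]
  exact Finset.sum_comm

theorem coeffMatrix_one {A : Type*} [CommRing A] (n : ℕ) :
    coeffMatrix n (1 : Matrix ι ι (PowerSeries A)) = if n = 0 then 1 else 0 := by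
  ext α β
  rw [coeffMatrix, Matrix.map_apply, Matrix.one_apply]
  by_cases h : α = β <;> by_cases hn : n = 0 <;>
    simp [h, hn, PowerSeries.coeff_one, Matrix.one_apply]

variable {A B : Type*} [CommRing A] [Algebra K A] [CommRing B] [Algebra K B]

theorem algebraMap_mul_map (φ : A →ₗ[K] B) (P : Matrix ι ι K) (M : Matrix ι ι A) :
    (P.map (algebraMap K A) * M).map φ = P.map (algebraMap K B) * M.map φ := by
  ext α β
  simp only [Matrix.map_apply, Matrix.mul_apply, map_sum, ← Algebra.smul_def, map_smul]

theorem mul_algebraMap_map (φ : A →ₗ[K] B) (P : Matrix ι ι K) (M : Matrix ι ι A) :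
    (M * P.map (algebraMap K A)).map φ = M.map φ * P.map (algebraMap K B) := by
  ext α β
  simp only [Matrix.map_apply, Matrix.mul_apply, map_sum, mul_comm _ (algebraMap _ _ _),
    ← Algebra.smul_def, map_smul]

theorem adjoint_map (φ : A →ₗ[K] B) (g : Matrix ι ι K) (S : Matrix ι ι A) :
    (adjoint g S).map φ = adjoint g (S.map φ) := by
  rw [adjoint, mul_algebraMap_map, algebraMap_mul_map, adjoint, Matrix.transpose_map]

theorem coeffMatrix_adjoint (n : ℕ) (g : Matrix ι ι K) (S : Matrix ι ι (PowerSeries A)) :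
    coeffMatrix n (adjoint g S) = adjoint g (coeffMatrix n S) :=
  adjoint_map ((PowerSeries.coeff n : PowerSeries A →ₗ[A] A).restrictScalars K) g S

variable {g : Matrix ι ι K}

theorem inv_map_mul_map (hg : IsUnit g.det) :
    g⁻¹.map (algebraMap K A) * g.map (algebraMap K A) = 1 := by
  rw [← Matrix.map_mul, Matrix.nonsing_inv_mul _ hg]
  simp

theorem map_mul_inv_map (hg : IsUnit g.det) :
    g.map (algebraMap K A) * g⁻¹.map (algebraMap K A) = 1 := by
  rw [← Matrix.map_mul, Matrix.mul_nonsing_inv _ hg]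
  simp

theorem inv_isSymm (hsymm : g.IsSymm) : g⁻¹.IsSymm := by
  rw [Matrix.IsSymm, Matrix.transpose_nonsing_inv, hsymm]

theorem adjoint_injective (hg : IsUnit g.det) :
    Function.Injective (adjoint g : Matrix ι ι A → Matrix ι ι A) := by
  intro S T h
  have key : ∀ M : Matrix ι ι A, g.map (algebraMap K A) * adjoint g M * g⁻¹.map (algebraMap K A)
      = M.transpose := by
    intro M
    rw [adjoint, ← Matrix.mul_assoc, ← Matrix.mul_assoc, map_mul_inv_map hg, Matrix.one_mul,
      Matrix.mul_assoc, map_mul_inv_map hg, Matrix.mul_one]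
  have h2 := key S
  rw [h, key T] at h2
  exact (Matrix.transpose_injective h2).symm

/-- `M = g⁻¹ N` with `N` symmetric is self-adjoint. -/
theorem adjoint_inv_mul (hg : IsUnit g.det) (hsymm : g.IsSymm) (N : Matrix ι ι A) :
    adjoint g (g⁻¹.map (algebraMap K A) * N) = g⁻¹.map (algebraMap K A) * N.transpose := by
  rw [adjoint, Matrix.transpose_mul, ← Matrix.transpose_map, inv_isSymm hsymm, ← Matrix.mul_assoc,
    Matrix.mul_assoc, inv_map_mul_map hg, Matrix.mul_one]

theorem adjoint_one (hg : IsUnit g.det) : adjoint g (1 : Matrix ι ι A) = 1 := by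
  rw [adjoint, Matrix.transpose_one, Matrix.mul_one, inv_map_mul_map hg]

theorem adjoint_mul (hg : IsUnit g.det) (S T : Matrix ι ι A) :
    adjoint g (S * T) = adjoint g T * adjoint g S := by
  simp only [adjoint, Matrix.transpose_mul, Matrix.mul_assoc]
  rw [← Matrix.mul_assoc (g.map _) (g⁻¹.map _), map_mul_inv_map hg, Matrix.one_mul]

end Matrices

/-! ### The Hessian of the potential on the small phase space -/

section Hessian

variable {ι K : Type*} [Fintype ι] [DecidableEq ι] [CommRing K]

/-- `∂_i ∂_j F` on the small phase space. -/
def smallHessian (F : MvPowerSeries (ι × ℕ) K) (i j : ι × ℕ) : MvPowerSeries ι K :=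
  smallHom (pderiv K i (pderiv K j F))

/-- The matrix of `∂_{α,k} ∂_{β,l} F` on the small phase space. -/
def hessianMatrix (F : MvPowerSeries (ι × ℕ) K) (k l : ℕ) : Matrix ι ι (MvPowerSeries ι K) :=
  Matrix.of fun α β => smallHessian F (α, k) (β, l)

/-- The scalar matrix `g⁻¹` over the formal functions of `τ`. -/
def invGram (g : Matrix ι ι K) : Matrix ι ι (MvPowerSeries ι K) :=
  g⁻¹.map (algebraMap K (MvPowerSeries ι K))

theorem smallHessian_comm (F : MvPowerSeries (ι × ℕ) K) (i j : ι × ℕ) :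
    smallHessian F i j = smallHessian F j i := by
  rw [smallHessian, pderiv_comm, smallHessian]

theorem hessianMatrix_transpose (F : MvPowerSeries (ι × ℕ) K) (k l : ℕ) :
    (hessianMatrix F k l).transpose = hessianMatrix F l k := by
  ext1 α β
  exact smallHessian_comm F _ _

variable {g : Matrix ι ι K} {i₀ : ι} {F : MvPowerSeries (ι × ℕ) K}

theorem TopologicalRecursion.smallHom_pderiv (hTRR : TopologicalRecursion g F) (α β γ : ι)
    (k l m : ℕ) :
    smallHom (pderiv K (α, k + 1) (pderiv K (β, l) (pderiv K (γ, m) F)))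
      = ∑ μ, ∑ ν, smallHessian F (α, k) (μ, 0) * invGram g μ ν
          * smallHom (pderiv K (ν, 0) (pderiv K (β, l) (pderiv K (γ, m) F))) := by
  rw [hTRR]
  simp only [map_sum, map_smul, map_mul, smallHessian, invGram, Matrix.map_apply]
  refine Finset.sum_congr rfl fun μ _ => Finset.sum_congr rfl fun ν _ => ?_
  rw [Algebra.smul_def]
  ring

variable [Algebra ℚ K]

/-- Evaluate ∂_{1,0}∂_{α,k+1}∂_{β,l+1}F in two ways. The string equation gives the left side. TRR
gives W_{k,0} g⁻¹ times the τ-gradient of ∂_{1,0}∂_{β,l+1}F, and the string equation turns that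
gradient into W_{0,l}. -/
theorem hessianMatrix_succ_add (hSE : StringEquation g i₀ F) (hTRR : TopologicalRecursion g F)
    (k l : ℕ) :
    hessianMatrix F (k + 1) l + hessianMatrix F k (l + 1)
      = hessianMatrix F k 0 * invGram g * hessianMatrix F 0 l := by
  ext1 α β
  have h := hTRR.smallHom_pderiv α i₀ β k 0 (l + 1)
  rw [pderiv_comm, hSE.smallHom_pderiv_succ_succ] at h
  simp only [← pderiv_smallHom _ (pderiv K (i₀, 0) _), hSE.smallHom_pderiv_succ] at h
  rw [Finset.sum_comm] at h
  simp only [Matrix.add_apply, Matrix.mul_apply, Finset.sum_mul, hessianMatrix, Matrix.of_apply]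
  refine h.trans (Finset.sum_congr rfl fun ν _ => Finset.sum_congr rfl fun μ _ => ?_)
  rw [pderiv_smallHom, smallHessian, smallHessian]

theorem quantumProduct_eq (l : ι) :
    quantumProduct g F l = invGram g * (hessianMatrix F 0 0).map (pderiv K l) := by
  ext1 μ δ
  simp only [quantumProduct, Matrix.of_apply, Matrix.mul_apply, invGram, Matrix.map_apply,
    ← Algebra.smul_def, hessianMatrix, smallHessian, smallPhase_eq, pderiv_smallHom]
  refine Finset.sum_congr rfl fun ν _ => ?_
  rw [pderiv_comm (l, 0) (ν, 0)]

theorem adjoint_quantumProduct (hg : IsUnit g.det) (hsymm : g.IsSymm) (l : ι) :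
    adjoint g (quantumProduct g F l) = quantumProduct g F l := by
  rw [quantumProduct_eq, invGram, adjoint_inv_mul hg hsymm, ← Matrix.transpose_map,
    hessianMatrix_transpose]

/-- TRR with all free derivatives along τ; multiplied by g⁻¹ this is the flatness equation for the
coefficients g⁻¹ W_{0,n+1}. -/
theorem hessianMatrix_map_pderiv (hsymm : g.IsSymm) (hTRR : TopologicalRecursion g F) (l : ι)
    (n : ℕ) :
    (hessianMatrix F 0 (n + 1)).map (pderiv K l)
      = (hessianMatrix F 0 0).map (pderiv K l) * invGram g * hessianMatrix F 0 n := by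
  ext1 α β
  have h := hTRR.smallHom_pderiv β l α n 0 0
  simp only [Matrix.map_apply, Matrix.mul_apply, Finset.sum_mul, hessianMatrix, Matrix.of_apply,
    smallHessian, pderiv_smallHom]
  rw [pderiv_comm (α, 0), pderiv_comm (l, 0), h]
  refine Finset.sum_congr rfl fun μ _ => Finset.sum_congr rfl fun ν _ => ?_
  rw [smallHessian, pderiv_comm (μ, 0), pderiv_comm (l, 0) (α, 0), pderiv_comm (ν, 0) (α, 0),
    pderiv_comm (ν, 0) (l, 0), invGram, Matrix.map_apply, Matrix.map_apply,
    (inv_isSymm hsymm).apply μ ν, pderiv_comm (α, 0) (l, 0)]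
  ring

theorem hessianMatrix_zero_apply (hsymm : g.IsSymm) (hSE : StringEquation g i₀ F) (α : ι) :
    hessianMatrix F 0 0 α i₀ = ∑ γ, g α γ • X γ := by
  rw [hessianMatrix, Matrix.of_apply, smallHessian_comm]
  exact hSE.smallHom_pderiv_zero hsymm α

/-- The τ^l-derivative of ∂_{1,0}∂_{ν,0}F = (φ_ν, τ) is g_{νl}, so φ_l • 1 = φ_l. -/
theorem quantumProduct_unit (hg : IsUnit g.det) (hsymm : g.IsSymm) (hSE : StringEquation g i₀ F)
    (l μ : ι) : quantumProduct g F l μ i₀ = if μ = l then 1 else 0 := by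
  rw [quantumProduct_eq, Matrix.mul_apply]
  have h : ∀ ν, (hessianMatrix F 0 0).map (pderiv K l) ν i₀
      = (g.map (algebraMap K (MvPowerSeries ι K))) ν l := by
    intro ν
    rw [Matrix.map_apply, hessianMatrix_zero_apply hsymm hSE, map_sum]
    simp [pderiv_X, Pi.single_apply, Algebra.smul_def]
  simp only [h]
  rw [← Matrix.mul_apply, invGram, inv_map_mul_map hg, Matrix.one_apply]

end Hessian

/-! ### The calibration -/

section Calibration

variable {ι K : Type*} [Fintype ι] [DecidableEq ι] [CommRing K]

/-- The coefficients `S_n` of the calibration. -/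
def calibrationCoeff (g : Matrix ι ι K) (F : MvPowerSeries (ι × ℕ) K) :
    ℕ → Matrix ι ι (MvPowerSeries ι K)
  | 0 => 1
  | n + 1 => invGram g * hessianMatrix F 0 n

/-- The coefficients of `S^*(-z)`. -/
def inverseCoeff (g : Matrix ι ι K) (F : MvPowerSeries (ι × ℕ) K) :
    ℕ → Matrix ι ι (MvPowerSeries ι K)
  | 0 => 1
  | n + 1 => (-1) ^ (n + 1) • (invGram g * hessianMatrix F n 0)

/-- The calibration `S(z) = 1 + ∑ g⁻¹ (∂_{α,0} ∂_{β,n} F) z^{-n-1}`. -/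
def calibration (g : Matrix ι ι K) (F : MvPowerSeries (ι × ℕ) K) :
    Matrix ι ι (PowerSeries (MvPowerSeries ι K)) :=
  Matrix.of fun α β => PowerSeries.mk fun n => calibrationCoeff g F n α β

variable {g : Matrix ι ι K} {i₀ : ι} {F : MvPowerSeries (ι × ℕ) K}

theorem coeffMatrix_calibration (n : ℕ) :
    coeffMatrix n (calibration g F) = calibrationCoeff g F n := by
  ext1 α β
  simp [coeffMatrix, calibration]

theorem adjoint_calibrationCoeff_succ (hg : IsUnit g.det) (hsymm : g.IsSymm) (n : ℕ) :
    adjoint g (calibrationCoeff g F (n + 1)) = invGram g * hessianMatrix F n 0 := by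
  rw [calibrationCoeff, invGram, adjoint_inv_mul hg hsymm, hessianMatrix_transpose]

theorem inverseCoeff_eq (hg : IsUnit g.det) (hsymm : g.IsSymm) (n : ℕ) :
    inverseCoeff g F n = (-1) ^ n • adjoint g (calibrationCoeff g F n) := by
  cases n with
  | zero => rw [calibrationCoeff, adjoint_one hg, inverseCoeff, pow_zero, one_smul]
  | succ n => rw [adjoint_calibrationCoeff_succ hg hsymm, inverseCoeff]

variable [Algebra ℚ K]

/-- By `hessianMatrix_succ_add` each product is a sum of two neighbouring matrices on the same
antidiagonal, so the alternating sum telescopes. The offset `n` is kept free for the induction. -/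
theorem sum_hessianMatrix_mul (hSE : StringEquation g i₀ F) (hTRR : TopologicalRecursion g F)
    (m n : ℕ) :
    ∑ i ∈ Finset.range m, (-1 : ℤ) ^ i •
        (hessianMatrix F i 0 * invGram g * hessianMatrix F 0 (n + (m - 1 - i)))
      = hessianMatrix F 0 (n + m) - (-1 : ℤ) ^ m • hessianMatrix F m n := by
  induction m generalizing n with
  | zero => simp
  | succ m ih =>
    have h := ih (n + 1)
    rw [Finset.sum_range_succ]
    have : ∀ i ∈ Finset.range m, n + (m + 1 - 1 - i) = n + 1 + (m - 1 - i) := by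
      intro i hi
      have := Finset.mem_range.mp hi
      omega
    rw [Finset.sum_congr rfl fun i hi => by rw [this i hi], h, Nat.add_sub_cancel, Nat.sub_self,
      add_zero, ← hessianMatrix_succ_add hSE hTRR, smul_add, pow_succ, add_assoc n 1 m,
      add_comm 1 m]
    simp only [mul_neg, mul_one, neg_smul]
    abel

/-- The inner terms of the convolution telescope to W_{0,m} and W_{m,0}, which cancel against the
two end terms, where one factor is 1. -/
theorem sum_inverseCoeff_mul (hSE : StringEquation g i₀ F) (hTRR : TopologicalRecursion g F)
    (n : ℕ) :
    ∑ i ∈ Finset.range (n + 1), inverseCoeff g F i * calibrationCoeff g F (n - i)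
      = if n = 0 then 1 else 0 := by
  cases n with
  | zero => simp [inverseCoeff, calibrationCoeff]
  | succ m =>
    rw [if_neg (Nat.succ_ne_zero m), Finset.sum_range_succ', Finset.sum_range_succ]
    have h := sum_hessianMatrix_mul (g := g) hSE hTRR m 0
    have hterm : ∀ i ∈ Finset.range m,
        inverseCoeff g F (i + 1) * calibrationCoeff g F (m + 1 - (i + 1))
          = -(invGram g * ((-1 : ℤ) ^ i •
            (hessianMatrix F i 0 * invGram g * hessianMatrix F 0 (0 + (m - 1 - i))))) := by
      intro i hi
      have := Finset.mem_range.mp hi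
      rw [show m + 1 - (i + 1) = (m - 1 - i) + 1 by omega, zero_add, inverseCoeff,
        calibrationCoeff, pow_succ]
      simp only [mul_neg, mul_one, neg_smul, Matrix.neg_mul, Matrix.smul_mul, Matrix.mul_smul,
        Matrix.mul_assoc]
    rw [Finset.sum_congr rfl hterm, Finset.sum_neg_distrib, ← Finset.mul_sum, h]
    simp only [inverseCoeff, calibrationCoeff, Nat.sub_self, Nat.sub_zero, zero_add, mul_one,
      one_mul, mul_sub, Matrix.mul_smul, pow_succ, mul_neg, neg_smul]
    abel

theorem coeffMatrix_evalNegHom {A : Type*} [CommRing A] (n : ℕ) (M : Matrix ι ι (PowerSeries A)) :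
    coeffMatrix n (M.map PowerSeries.evalNegHom) = (-1 : ℤ) ^ n • coeffMatrix n M := by
  ext1 α β
  simp [coeffMatrix, PowerSeries.evalNegHom, PowerSeries.coeff_rescale]

theorem adjoint_evalNegHom_mul_calibration (hg : IsUnit g.det) (hsymm : g.IsSymm)
    (hSE : StringEquation g i₀ F) (hTRR : TopologicalRecursion g F) :
    (adjoint g (calibration g F)).map PowerSeries.evalNegHom * calibration g F = 1 := by
  refine ext_coeffMatrix fun n => ?_
  rw [coeffMatrix_mul, coeffMatrix_one, ← sum_inverseCoeff_mul hSE hTRR,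
    Finset.Nat.sum_antidiagonal_eq_sum_range_succ_mk]
  refine Finset.sum_congr rfl fun i _ => ?_
  rw [coeffMatrix_evalNegHom, coeffMatrix_adjoint, coeffMatrix_calibration,
    coeffMatrix_calibration, inverseCoeff_eq hg hsymm]

/-- For square matrices over a commutative ring a left inverse is a right inverse. -/
theorem sum_calibrationCoeff_mul (hg : IsUnit g.det) (hsymm : g.IsSymm)
    (hSE : StringEquation g i₀ F) (hTRR : TopologicalRecursion g F) (n : ℕ) :
    ∑ i ∈ Finset.range (n + 1), calibrationCoeff g F i * inverseCoeff g F (n - i)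
      = if n = 0 then 1 else 0 := by
  have h := congrArg (coeffMatrix n)
    (mul_eq_one_comm.mp (adjoint_evalNegHom_mul_calibration hg hsymm hSE hTRR))
  rw [coeffMatrix_mul, coeffMatrix_one, Finset.Nat.sum_antidiagonal_eq_sum_range_succ_mk] at h
  rw [← h]
  refine Finset.sum_congr rfl fun i _ => ?_
  rw [coeffMatrix_evalNegHom, coeffMatrix_adjoint, coeffMatrix_calibration,
    coeffMatrix_calibration, inverseCoeff_eq hg hsymm]

theorem calibrationCoeff_flat (hsymm : g.IsSymm) (hTRR : TopologicalRecursion g F) (l : ι)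
    (n : ℕ) :
    (calibrationCoeff g F (n + 1)).map (pderiv K l)
      = quantumProduct g F l * calibrationCoeff g F n := by
  rw [quantumProduct_eq, calibrationCoeff, invGram]
  have := algebraMap_mul_map (pderiv K l).toLinearMap g⁻¹ (hessianMatrix F 0 n)
  refine this.trans ?_
  cases n with
  | zero => rw [calibrationCoeff, Matrix.mul_one]; rfl
  | succ n =>
    rw [calibrationCoeff, Matrix.mul_assoc, ← Matrix.mul_assoc _ (invGram g),
      ← hessianMatrix_map_pderiv hsymm hTRR]
    rfl

end Calibration

/-! ### The `J`-function -/

section JFunction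

variable {ι K : Type*} [Fintype ι] [DecidableEq ι] [CommRing K]

/-- Only the z^{-k-1} coefficient of f pairs with z^k; the sign comes from f(-z). -/
theorem omega_zMonomial {R : Type*} [CommRing R] [Algebra K R] (g : Matrix ι ι K) (f : Loop ι R)
    (α : ι) (k : ℕ) :
    Omega g f (zMonomial α k)
      = (-1) ^ (k + 1) * ∑ β, algebraMap K R (g β α) * zCoeff f (-((k + 1 : ℕ) : ℤ)) β := by
  have h : ∀ β γ, (negLoop f β * (zMonomial α k : Loop ι R) γ).coeff 1
      = if γ = α then (-1) ^ (k + 1) * zCoeff f (-((k + 1 : ℕ) : ℤ)) β else 0 := by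
    intro β γ
    rw [zMonomial]
    by_cases hγ : γ = α
    · rw [hγ, Pi.single_eq_same, if_pos rfl, mul_comm, HahnSeries.coeff_single_mul, one_mul,
        sub_neg_eq_add, negLoop, negSeries, zCoeff, neg_neg]
      simp only [add_comm (1 : ℤ)]
      norm_cast
    · rw [Pi.single_eq_of_ne hγ, if_neg hγ, mul_zero, HahnSeries.coeff_zero]
  simp only [Omega, h, mul_ite, mul_zero, Finset.sum_ite_eq', Finset.mem_univ, if_true,
    Finset.mul_sum]
  exact Finset.sum_congr rfl fun β _ => by ring

theorem coeff_ofPowerSeries_neg {R : Type*} [CommRing R] (s : PowerSeries R) {n : ℤ} (hn : n < 0) :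
    (HahnSeries.ofPowerSeries ℤ R s).coeff n = 0 := by
  rw [PowerSeries.coeff_coe, if_pos hn]

/-- With J = z s, the coefficients of s in degrees 0 and 1 are the z and z^0 parts of J, fixed by
the position -z + τ. The covector component at index k sees z^{-k-1}, that is degree k + 2 of s; the
signs from J(-z) and from Ω cancel. -/
theorem isJFunction_iff (g : Matrix ι ι K) (i₀ : ι) (F : MvPowerSeries (ι × ℕ) K)
    (s : ι → PowerSeries (MvPowerSeries ι K)) :
    IsJFunction g i₀ F (fun α => HahnSeries.single (-1) 1 * HahnSeries.ofPowerSeries ℤ _ (s α)) ↔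
      (∀ α, PowerSeries.coeff 0 (s α) = if α = i₀ then 1 else 0) ∧
      (∀ α, PowerSeries.coeff 1 (s α) = X α) ∧
      ∀ α k, ∑ β, algebraMap K _ (g β α) * PowerSeries.coeff (k + 2) (s β)
        = smallHom (pderiv K (α, k) F) := by
  set J : Loop ι (MvPowerSeries ι K) :=
    fun α => HahnSeries.single (-1) 1 * HahnSeries.ofPowerSeries ℤ _ (s α) with hJ
  have hcoeff : ∀ α n, (J α).coeff n = (HahnSeries.ofPowerSeries ℤ _ (s α)).coeff (n + 1) := by
    intro α n
    rw [hJ, HahnSeries.coeff_single_mul, one_mul, sub_neg_eq_add]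
  have hneg : ∀ n α, zCoeff (negLoop J) n α = (-1) ^ n.natAbs
      * (HahnSeries.ofPowerSeries ℤ _ (s α)).coeff (-n + 1) := by
    intro n α
    rw [zCoeff, negLoop, negSeries]
    simp only [hcoeff, Int.natAbs_neg]
  have hmom : ∀ α k, Omega g (negLoop J) (zMonomial α k)
      = ∑ β, algebraMap K _ (g β α) * PowerSeries.coeff (k + 2) (s β) := by
    intro α k
    rw [omega_zMonomial, Finset.mul_sum]
    refine Finset.sum_congr rfl fun β _ => ?_
    rw [hneg, neg_neg, show (((k + 1 : ℕ) : ℤ) + 1) = ((k + 2 : ℕ) : ℤ) by push_cast; ring,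
      HahnSeries.ofPowerSeries_apply_coeff, Int.natAbs_neg, Int.natAbs_natCast, mul_left_comm,
      ← mul_assoc ((-1 : MvPowerSeries ι K) ^ _), ← mul_pow]
    simp
  have hpos : HasPosition i₀ (negLoop J) (smallPoint : ι × ℕ →₀ MvPowerSeries ι K) ↔
      (∀ α, PowerSeries.coeff 0 (s α) = if α = i₀ then 1 else 0) ∧
      (∀ α, PowerSeries.coeff 1 (s α) = X α) := by
    have h0 : ∀ α, zCoeff (negLoop J) ((0 : ℕ) : ℤ) α = PowerSeries.coeff 1 (s α) := by
      intro α
      rw [hneg]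
      simpa using HahnSeries.ofPowerSeries_apply_coeff (Γ := ℤ) (s α) 1
    have h1 : ∀ α, zCoeff (negLoop J) ((1 : ℕ) : ℤ) α = -PowerSeries.coeff 0 (s α) := by
      intro α
      rw [hneg]
      simpa using HahnSeries.ofPowerSeries_apply_coeff (Γ := ℤ) (s α) 0
    have h2 : ∀ α k, zCoeff (negLoop J) ((k + 2 : ℕ) : ℤ) α = 0 := by
      intro α k
      rw [hneg, coeff_ofPowerSeries_neg _ (by push_cast; omega), mul_zero]
    have d0 : ∀ α, dilatonShift i₀ (smallPoint : ι × ℕ →₀ MvPowerSeries ι K) (α, 0) = X α := by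
      intro α
      simp [dilatonShift, smallPoint_zero]
    have d1 : ∀ α, dilatonShift i₀ (smallPoint : ι × ℕ →₀ MvPowerSeries ι K) (α, 1)
        = -(if α = i₀ then 1 else 0) := by
      intro α
      rw [dilatonShift, Finsupp.sub_apply, smallPoint_succ, Finsupp.single_apply]
      simp [eq_comm]
    have d2 : ∀ α k, dilatonShift i₀ (smallPoint : ι × ℕ →₀ MvPowerSeries ι K) (α, k + 2) = 0 := by
      intro α k
      rw [dilatonShift, Finsupp.sub_apply, smallPoint_succ, Finsupp.single_apply]
      simp
    constructor
    · intro h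
      refine ⟨fun α => ?_, fun α => ?_⟩
      · have := h α 1
        rw [h1, d1] at this
        exact neg_injective this
      · have := h α 0
        rwa [h0, d0] at this
    · rintro ⟨ha, hb⟩ α k
      match k with
      | 0 => rw [h0, d0, hb]
      | 1 => rw [h1, d1, ha]
      | k + 2 => rw [h2, d2]
  rw [IsJFunction, IsGraphPoint, hpos, and_assoc]
  simp only [hmom, smallPhase_eq]

variable [Algebra ℚ K] {g : Matrix ι ι K} {i₀ : ι} {F : MvPowerSeries (ι × ℕ) K}

/-- This is S_1 1 = τ, the source of the shift by τ between positions on L and on L_τ. -/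
theorem invGram_mul_hessianMatrix_zero (hg : IsUnit g.det) (hsymm : g.IsSymm)
    (hSE : StringEquation g i₀ F) (α : ι) :
    (invGram g * hessianMatrix F 0 0) α i₀ = X α := by
  have h : ∀ ν, hessianMatrix F 0 0 ν i₀
      = ∑ γ, (g.map (algebraMap K (MvPowerSeries ι K))) ν γ * X γ := by
    intro ν
    simp only [hessianMatrix_zero_apply hsymm hSE, Algebra.smul_def, Matrix.map_apply]
  rw [Matrix.mul_apply]
  simp only [h]
  change Matrix.mulVec (invGram g) (Matrix.mulVec _ fun γ => X γ) α = X α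
  rw [Matrix.mulVec_mulVec, invGram, inv_map_mul_map hg, Matrix.one_mulVec]

theorem isCalibration_calibration (hg : IsUnit g.det) (hsymm : g.IsSymm)
    (hSE : StringEquation g i₀ F) (hTRR : TopologicalRecursion g F) :
    IsCalibration g i₀ F (calibration g F) where
  leading := coeffMatrix_calibration 0
  symplectic := adjoint_evalNegHom_mul_calibration hg hsymm hSE hTRR
  flat l n := by
    have h := calibrationCoeff_flat hsymm hTRR l n
    rw [← coeffMatrix_calibration, ← coeffMatrix_calibration] at h
    exact h
  jFunction := by
    rw [isJFunction_iff]
    have h : ∀ n α, PowerSeries.coeff n (adjoint g (calibration g F) α i₀)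
        = adjoint g (calibrationCoeff g F n) α i₀ := by
      intro n α
      rw [← coeffMatrix_calibration, ← coeffMatrix_adjoint, coeffMatrix, Matrix.map_apply]
    simp only [h, adjoint_calibrationCoeff_succ hg hsymm]
    refine ⟨fun α => ?_, fun α => ?_, fun α k => ?_⟩
    · rw [calibrationCoeff, adjoint_one hg, Matrix.one_apply]
    · exact invGram_mul_hessianMatrix_zero hg hsymm hSE α
    · have h2 : ∀ ν, hessianMatrix F (k + 1) 0 ν i₀ = smallHom (pderiv K (ν, k) F) := by
        intro ν
        rw [hessianMatrix, Matrix.of_apply, smallHessian_comm]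
        exact hSE.smallHom_pderiv_succ ν k
      have h3 : (g.map (algebraMap K (MvPowerSeries ι K))
          * (invGram g * hessianMatrix F (k + 1) 0)) α i₀ = smallHom (pderiv K (α, k) F) := by
        rw [← Matrix.mul_assoc, invGram, map_mul_inv_map hg, Matrix.one_mul, h2]
      rw [Matrix.mul_apply] at h3
      rw [← h3]
      refine Finset.sum_congr rfl fun β _ => ?_
      rw [Matrix.map_apply, hsymm.apply]

/-- The columns of `S^*` are the derivatives of the `J`-function. -/
theorem IsCalibration.coeffMatrix_adjoint_apply (hg : IsUnit g.det) (hsymm : g.IsSymm)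
    (hSE : StringEquation g i₀ F) {S : Matrix ι ι (PowerSeries (MvPowerSeries ι K))}
    (hS : IsCalibration g i₀ F S) (n : ℕ) (α l : ι) :
    coeffMatrix n (adjoint g S) α l = pderiv K l (coeffMatrix (n + 1) (adjoint g S) α i₀) := by
  have h : (coeffMatrix (n + 1) S).map (pderiv K l).toLinearMap
      = quantumProduct g F l * coeffMatrix n S := hS.flat l n
  -- Quantum multiplication is self-adjoint, so taking adjoints puts φ_l • to the right of S_n^*.
  -- Column `i₀` then gives S_n^*(φ_l • 1) = S_n^* φ_l.
  have h2 := congrArg (adjoint g) h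
  rw [adjoint_mul hg, adjoint_quantumProduct hg hsymm, ← adjoint_map, ← coeffMatrix_adjoint,
    ← coeffMatrix_adjoint] at h2
  have h3 := congrFun (congrFun h2 α) i₀
  rw [Matrix.map_apply, Matrix.mul_apply] at h3
  simp only [quantumProduct_unit hg hsymm hSE, mul_ite, mul_one, mul_zero, Finset.sum_ite_eq',
    Finset.mem_univ, if_true] at h3
  exact h3.symm

/-- The J-function fixes S^* 1 in every positive degree, since g can be cancelled; column l in
degree n is the τ^l-derivative of S^* 1 in degree n + 1. -/
theorem IsCalibration.unique (hg : IsUnit g.det) (hsymm : g.IsSymm)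
    (hSE : StringEquation g i₀ F) {S T : Matrix ι ι (PowerSeries (MvPowerSeries ι K))}
    (hS : IsCalibration g i₀ F S) (hT : IsCalibration g i₀ F T) : S = T := by
  have hJS := (isJFunction_iff _ _ _ _).mp hS.jFunction
  have hJT := (isJFunction_iff _ _ _ _).mp hT.jFunction
  have hcol : ∀ n α, coeffMatrix (n + 1) (adjoint g S) α i₀
      = coeffMatrix (n + 1) (adjoint g T) α i₀ := by
    intro n
    cases n with
    | zero => exact fun α => (hJS.2.1 α).trans (hJT.2.1 α).symm
    | succ k =>
      have hv : Matrix.mulVec (g.map (algebraMap K (MvPowerSeries ι K)))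
            (fun β => PowerSeries.coeff (k + 2) (adjoint g S β i₀))
          = Matrix.mulVec (g.map (algebraMap K (MvPowerSeries ι K)))
            (fun β => PowerSeries.coeff (k + 2) (adjoint g T β i₀)) := by
        funext α
        have := (hJS.2.2 α k).trans (hJT.2.2 α k).symm
        simp only [hsymm.apply] at this
        exact this
      have := congrArg (Matrix.mulVec (g⁻¹.map (algebraMap K (MvPowerSeries ι K)))) hv
      rw [Matrix.mulVec_mulVec, Matrix.mulVec_mulVec, inv_map_mul_map hg, Matrix.one_mulVec,
        Matrix.one_mulVec] at this
      exact fun α => congrFun this α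
  refine adjoint_injective hg (ext_coeffMatrix fun n => ?_)
  ext1 α l
  rw [hS.coeffMatrix_adjoint_apply hg hsymm hSE, hT.coeffMatrix_adjoint_apply hg hsymm hSE, hcol]

end JFunction

/-! ### Block triangular operators on `H_+` -/

section Upper

variable {ι R : Type*} [Fintype ι] [DecidableEq ι] [CommRing R]

/-- The image of `φ_α z^k` under the `H_+`-component of `∑ C_n z^{-n}`. -/
def upperCol (C : ℕ → Matrix ι ι R) (a : ι × ℕ) : ι × ℕ →₀ R :=
  Finsupp.onFinset (Finset.univ ×ˢ Finset.range (a.2 + 1))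
    (fun i => if i.2 ≤ a.2 then C (a.2 - i.2) i.1 a.1 else 0)
    (fun i hi => by
      have : i.2 ≤ a.2 := by
        by_contra h
        exact hi (if_neg h)
      simpa using Nat.lt_succ_of_le this)

/-- The `H_+`-component of the action of `∑ C_n z^{-n}` on `H_+`. -/
def upper (C : ℕ → Matrix ι ι R) : (ι × ℕ →₀ R) →ₗ[R] (ι × ℕ →₀ R) :=
  Finsupp.linearCombination R (upperCol C)

theorem upperCol_apply (C : ℕ → Matrix ι ι R) (a i : ι × ℕ) :
    upperCol C a i = if i.2 ≤ a.2 then C (a.2 - i.2) i.1 a.1 else 0 := rfl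

theorem upperCol_sum {M : Type*} [AddCommMonoid M] (C : ℕ → Matrix ι ι R) (a : ι × ℕ)
    (f : ι × ℕ → R → M) (hf : ∀ i, f i 0 = 0) :
    (upperCol C a).sum f
      = ∑ l ∈ Finset.range (a.2 + 1), ∑ β, f (β, l) (C (a.2 - l) β a.1) := by
  rw [upperCol, Finsupp.onFinset_sum _ hf, Finset.sum_product_right]
  refine Finset.sum_congr rfl fun l hl => Finset.sum_congr rfl fun β _ => ?_
  rw [if_pos (Nat.le_of_lt_succ (Finset.mem_range.mp hl))]

theorem upper_apply (C : ℕ → Matrix ι ι R) (q : ι × ℕ →₀ R) (i : ι × ℕ) :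
    upper C q i = q.sum fun a c => c * upperCol C a i := by
  rw [upper, Finsupp.linearCombination_apply, Finsupp.sum_apply]
  rfl

theorem upper_single (C : ℕ → Matrix ι ι R) (a : ι × ℕ) :
    upper C (Finsupp.single a 1) = upperCol C a := by
  rw [upper, Finsupp.linearCombination_single, one_smul]

theorem upperCol_zero {C : ℕ → Matrix ι ι R} (hC : C 0 = 1) (α : ι) :
    upperCol C (α, 0) = Finsupp.single (α, 0) 1 := by
  ext ⟨β, k⟩
  rw [upperCol_apply, Finsupp.single_apply]
  by_cases hk : k = 0 <;> simp [hk, hC, Matrix.one_apply, eq_comm]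

/-- Series in z⁻¹ preserve H_-, so truncating to H_+ is compatible with composition; inverse series
therefore induce inverse maps of H_+. -/
theorem upper_upper {C D : ℕ → Matrix ι ι R}
    (h : ∀ n, ∑ i ∈ Finset.range (n + 1), C i * D (n - i) = if n = 0 then 1 else 0)
    (q : ι × ℕ →₀ R) : upper C (upper D q) = q := by
  suffices H : (upper C).comp (upper D) = LinearMap.id from LinearMap.congr_fun H q
  refine Finsupp.lhom_ext' fun b => LinearMap.ext_ring ?_
  rw [LinearMap.comp_apply, LinearMap.comp_apply, LinearMap.comp_apply, Finsupp.lsingle_apply,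
    LinearMap.id_apply, upper_single]
  ext ⟨α, k⟩
  obtain ⟨β, l⟩ := b
  rw [upper_apply, upperCol_sum D _ (fun a c => c * upperCol C a (α, k)) fun i => zero_mul _]
  have hterm : ∀ j ∈ Finset.range (l + 1),
      ∑ γ, D (l - j) γ β * upperCol C (γ, j) (α, k)
        = if k ≤ j then (C (j - k) * D (l - j)) α β else 0 := by
    intro j _
    simp only [upperCol_apply]
    split_ifs
    · rw [Matrix.mul_apply]
      exact Finset.sum_congr rfl fun γ _ => mul_comm _ _
    · simp
  rw [Finset.sum_congr rfl hterm, ← Finset.sum_filter]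
  by_cases hkl : k ≤ l
  · have hf : (Finset.range (l + 1)).filter (fun j => k ≤ j) = Finset.Ico k (l + 1) := by
      ext j
      simp only [Finset.mem_filter, Finset.mem_range, Finset.mem_Ico]
      omega
    have hs := congrFun (congrFun (h (l - k)) α) β
    rw [Matrix.sum_apply] at hs
    rw [hf, Finset.sum_Ico_eq_sum_range, show l + 1 - k = l - k + 1 by omega]
    refine (Finset.sum_congr rfl fun i _ => ?_).trans (hs.trans ?_)
    · rw [Nat.add_sub_cancel_left, Nat.sub_sub]
    · rw [Finsupp.single_apply]
      by_cases hlk : l = k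
      · subst hlk
        simp [Matrix.one_apply, eq_comm]
      · have h1 : l - k ≠ 0 := by omega
        have h2 : ¬ (β, l) = (α, k) := fun e => hlk (Prod.mk.inj e).2
        rw [if_neg h1, if_neg h2]
        rfl
  · rw [Finset.sum_eq_zero, Finsupp.single_apply, if_neg]
    · intro e
      exact hkl (Prod.mk.inj e).2.ge
    · intro j hj
      rw [Finset.mem_filter, Finset.mem_range] at hj
      omega

theorem exists_forall_eq_zero (q : ι × ℕ →₀ R) :
    ∃ L, ∀ α k, L ≤ k → q (α, k) = 0 := by
  refine ⟨q.support.sup Prod.snd + 1, fun α k hk => ?_⟩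
  by_contra h
  have : k ≤ q.support.sup Prod.snd :=
    Finset.le_sup (f := Prod.snd) (Finsupp.mem_support_iff.mpr h)
  omega

theorem sum_eq_sum_range {M : Type*} [AddCommMonoid M] {q : ι × ℕ →₀ R} {L : ℕ}
    (hL : ∀ α k, L ≤ k → q (α, k) = 0) (f : ι × ℕ → R → M) (hf : ∀ i, f i 0 = 0) :
    q.sum f = ∑ l ∈ Finset.range L, ∑ β, f (β, l) (q (β, l)) := by
  rw [Finsupp.sum_of_support_subset q (s := Finset.univ ×ˢ Finset.range L) ?_ f fun i _ => hf i,
    Finset.sum_product_right]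
  rintro ⟨α, k⟩ h
  rw [Finset.mem_product, Finset.mem_range]
  refine ⟨Finset.mem_univ _, ?_⟩
  by_contra hk
  exact Finsupp.mem_support_iff.mp h (hL α k (not_lt.mp hk))

end Upper

/-! ### The action of power series in `z⁻¹` on loops -/

section Action

variable {ι R : Type*} [Fintype ι] [DecidableEq ι] [CommRing R]

theorem coeff_ofPowerSeries_mul (s : PowerSeries R) (h : LaurentSeries R) (n : ℤ) (N : ℕ)
    (hN : ∀ m : ℕ, N ≤ m → h.coeff (n - m) = 0) :
    (HahnSeries.ofPowerSeries ℤ R s * h).coeff n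
      = ∑ m ∈ Finset.range N, PowerSeries.coeff m s * h.coeff (n - m) := by
  let e : ℕ ↪ ℤ × ℤ := ⟨fun m => ((m : ℤ), n - m), fun a b hab => by simpa using hab⟩
  have hs : ∀ m : ℕ, PowerSeries.coeff m s * h.coeff (n - m)
      = (HahnSeries.ofPowerSeries ℤ R s).coeff (e m).1 * h.coeff (e m).2 := fun m => by
    rw [← HahnSeries.ofPowerSeries_apply_coeff (Γ := ℤ)]
    rfl
  rw [HahnSeries.coeff_mul, Finset.sum_congr rfl fun m _ => hs m,
    ← Finset.sum_map (Finset.range N) e fun p =>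
      (HahnSeries.ofPowerSeries ℤ R s).coeff p.1 * h.coeff p.2]
  refine Finset.sum_subset ?_ ?_
  · rintro ⟨i, j⟩ hij
    rw [Finset.mem_antidiagonal] at hij
    obtain ⟨hi, hj, hsum⟩ := hij
    have hi0 : 0 ≤ i := by
      by_contra hneg
      exact hi (coeff_ofPowerSeries_neg s (not_le.mp hneg))
    lift i to ℕ using hi0
    obtain rfl : j = n - i := by simp only at hsum; omega
    rw [Finset.mem_map]
    refine ⟨i, Finset.mem_range.mpr ?_, rfl⟩
    by_contra hge
    exact hj (hN i (not_lt.mp hge))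
  · rintro ⟨i, j⟩ hmem hnot
    rw [Finset.mem_map] at hmem
    obtain ⟨m, -, hm⟩ := hmem
    obtain ⟨rfl, rfl⟩ := Prod.mk.inj hm
    rw [Finset.mem_antidiagonal] at hnot
    by_contra hne
    exact hnot ⟨left_ne_zero_of_mul hne, right_ne_zero_of_mul hne, by simp⟩

/-- The operator `∑ C_n z^{-n}` on loops. -/
def seriesMatrix (C : ℕ → Matrix ι ι R) : Matrix ι ι (LaurentSeries R) :=
  Matrix.of fun α β => HahnSeries.ofPowerSeries ℤ R (PowerSeries.mk fun n => C n α β)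

theorem zCoeff_seriesMatrix_mulVec (C : ℕ → Matrix ι ι R) (f : Loop ι R) (n : ℤ) (N : ℕ)
    (hN : ∀ (m : ℕ) β, N ≤ m → zCoeff f (n + m) β = 0) :
    zCoeff ((seriesMatrix C).mulVec f) n
      = ∑ m ∈ Finset.range N, (C m).mulVec (zCoeff f (n + m)) := by
  funext α
  rw [zCoeff, Matrix.mulVec, dotProduct, HahnSeries.coeff_sum, Finset.sum_apply]
  simp only [Matrix.mulVec, dotProduct]
  rw [Finset.sum_comm]
  refine Finset.sum_congr rfl fun β _ => ?_
  rw [seriesMatrix, Matrix.of_apply, coeff_ofPowerSeries_mul _ _ _ N]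
  · refine Finset.sum_congr rfl fun m _ => ?_
    rw [PowerSeries.coeff_mk, zCoeff, neg_add']
  · intro m hm
    rw [← neg_add']
    exact hN m β hm

variable {i₀ : ι}

/-- Nonpositive powers of z cannot bring H_- into H_+, so the new position depends only on the old
one. -/
theorem HasPosition.seriesMatrix_mulVec (C : ℕ → Matrix ι ι R) {f : Loop ι R}
    {t : ι × ℕ →₀ R} (hf : HasPosition i₀ f t) (α : ι) (k : ℕ) :
    zCoeff ((seriesMatrix C).mulVec f) k α = upper C (dilatonShift i₀ t) (α, k) := by
  obtain ⟨L, hL⟩ := exists_forall_eq_zero (dilatonShift i₀ t)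
  rw [zCoeff_seriesMatrix_mulVec C f k L, upper_apply,
    sum_eq_sum_range (L := k + L) (fun α l hl => hL α l (by omega))
      (fun a c => c * upperCol C a (α, k)) fun i => zero_mul _,
    Finset.sum_range_add, Finset.sum_apply]
  · have hz : ∑ l ∈ Finset.range k, ∑ β,
        dilatonShift i₀ t (β, l) * upperCol C (β, l) (α, k) = 0 := by
      refine Finset.sum_eq_zero fun l hl => Finset.sum_eq_zero fun β _ => ?_
      rw [upperCol_apply, if_neg (not_le.mpr (Finset.mem_range.mp hl)), mul_zero]
    rw [hz, zero_add]
    refine Finset.sum_congr rfl fun m _ => ?_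
    refine Finset.sum_congr rfl fun β _ => ?_
    rw [upperCol_apply, if_pos (Nat.le_add_right k m), Nat.add_sub_cancel_left, mul_comm,
      ← hf β (k + m), Nat.cast_add]
  · intro m β hm
    rw [← Nat.cast_add, hf]
    exact hL _ _ (by omega)

end Action

/-! ### The action of the calibration on cotangent vectors -/

section Momentum

variable {ι K : Type*} [Fintype ι] [DecidableEq ι] [CommRing K] [Algebra ℚ K]
  {g : Matrix ι ι K} {i₀ : ι} {F : MvPowerSeries (ι × ℕ) K}

/-- In loop terms: what S moves from z^k down into H_- is what S makes of the H_- vector whose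
covector is -W(τ) applied to z^k. Pushing the identity for W_{l,k+1} through the sum turns the case
(m, k + 1) into (m + 1, k), so `k` must stay free. -/
theorem calibrationCoeff_add (hSE : StringEquation g i₀ F) (hTRR : TopologicalRecursion g F)
    (m k : ℕ) :
    calibrationCoeff g F (m + 1 + k)
      = ∑ l ∈ Finset.range (m + 1), (-1 : ℤ) ^ l •
          (calibrationCoeff g F (m - l) * invGram g * hessianMatrix F l k) := by
  induction m generalizing k with
  | zero =>
    rw [Finset.sum_range_one, zero_add, Nat.sub_self, add_comm]
    simp [calibrationCoeff]
  | succ m ih =>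
    have hW : ∀ l, hessianMatrix F l (k + 1)
        = hessianMatrix F l 0 * invGram g * hessianMatrix F 0 k - hessianMatrix F (l + 1) k :=
      fun l => by rw [← hessianMatrix_succ_add hSE hTRR]; abel
    have h0 : calibrationCoeff g F (m + 1) * invGram g * hessianMatrix F 0 k
        = ∑ l ∈ Finset.range (m + 1), (-1 : ℤ) ^ l • (calibrationCoeff g F (m - l) * invGram g
            * (hessianMatrix F l 0 * invGram g * hessianMatrix F 0 k)) := by
      have := ih 0
      rw [add_zero] at this
      rw [this, Matrix.sum_mul, Matrix.sum_mul]
      refine Finset.sum_congr rfl fun l _ => ?_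
      simp only [Matrix.smul_mul, Matrix.mul_assoc]
    rw [show m + 1 + 1 + k = m + 1 + (k + 1) by ring, ih (k + 1), Finset.sum_range_succ' _ (m + 1),
      pow_zero, one_smul, Nat.sub_zero, h0, ← Finset.sum_add_distrib]
    refine Finset.sum_congr rfl fun l _ => ?_
    rw [hW, Nat.succ_sub_succ, pow_succ, mul_sub, smul_sub]
    simp only [mul_neg, mul_one, neg_smul]
    abel

variable {R : Type*} [CommRing R] [Algebra K R]

/-- The difference of a covector `p` at `q` and the value at `q` of the Hessian at `τ`, where
`φ` evaluates formal functions of `τ`. -/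
def reducedMomentum (F : MvPowerSeries (ι × ℕ) K) (φ : MvPowerSeries ι K →ₐ[K] R)
    (q : ι × ℕ →₀ R) (p : ι × ℕ → R) (i : ι × ℕ) : R :=
  p i - q.sum fun j c => c * φ (smallHessian F i j)

/-- The coefficients of `S(z, τ)`. -/
def calibrationEval (g : Matrix ι ι K) (F : MvPowerSeries (ι × ℕ) K)
    (φ : MvPowerSeries ι K →ₐ[K] R) (n : ℕ) : Matrix ι ι R :=
  (calibrationCoeff g F n).map φ

/-- The coefficients of `S(z, τ)⁻¹`. -/
def inverseEval (g : Matrix ι ι K) (F : MvPowerSeries (ι × ℕ) K)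
    (φ : MvPowerSeries ι K →ₐ[K] R) (n : ℕ) : Matrix ι ι R :=
  (inverseCoeff g F n).map φ

variable (φ : MvPowerSeries ι K →ₐ[K] R)

theorem invGram_map : (invGram g).map φ = g⁻¹.map (algebraMap K R) := by
  ext1 α β
  simp [invGram]

theorem map_zsmul_matrix (c : ℤ) (M : Matrix ι ι (MvPowerSeries ι K)) :
    (c • M).map φ = c • M.map φ := by
  ext1 α β
  rw [Matrix.map_apply, Matrix.smul_apply, Matrix.smul_apply, map_zsmul, Matrix.map_apply]

theorem sum_map_matrix {I : Type*} (s : Finset I) (M : I → Matrix ι ι (MvPowerSeries ι K)) :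
    (∑ i ∈ s, M i).map φ = ∑ i ∈ s, (M i).map φ := by
  ext1 α β
  simp [Matrix.map_apply, Matrix.sum_apply]

theorem inverseEval_transpose (hg : IsUnit g.det) (hsymm : g.IsSymm) (n : ℕ) :
    (inverseEval g F φ n).transpose = (-1 : ℤ) ^ n • (g.map (algebraMap K R)
      * calibrationEval g F φ n * g⁻¹.map (algebraMap K R)) := by
  have h1 : (g.map (algebraMap K R)).transpose = g.map (algebraMap K R) := by
    rw [← Matrix.transpose_map, hsymm]
  have h2 : (g⁻¹.map (algebraMap K R)).transpose = g⁻¹.map (algebraMap K R) := by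
    rw [← Matrix.transpose_map, inv_isSymm hsymm]
  rw [inverseEval, inverseCoeff_eq hg hsymm, map_zsmul_matrix, Matrix.transpose_smul]
  have := adjoint_map φ.toLinearMap g (calibrationCoeff g F n)
  rw [show (adjoint g (calibrationCoeff g F n)).map φ = _ from this, adjoint,
    Matrix.transpose_mul, Matrix.transpose_mul, h1, h2, Matrix.transpose_transpose,
    Matrix.mul_assoc]
  rfl

theorem sum_calibrationEval_mul (hg : IsUnit g.det) (hsymm : g.IsSymm)
    (hSE : StringEquation g i₀ F) (hTRR : TopologicalRecursion g F) (n : ℕ) :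
    ∑ i ∈ Finset.range (n + 1), calibrationEval g F φ i * inverseEval g F φ (n - i)
      = if n = 0 then 1 else 0 := by
  have := congrArg (fun M : Matrix ι ι (MvPowerSeries ι K) => M.map φ)
    (sum_calibrationCoeff_mul hg hsymm hSE hTRR n)
  simp only [sum_map_matrix, Matrix.map_mul] at this
  refine this.trans ?_
  split_ifs <;> simp

theorem sum_inverseEval_mul (hSE : StringEquation g i₀ F) (hTRR : TopologicalRecursion g F)
    (n : ℕ) :
    ∑ i ∈ Finset.range (n + 1), inverseEval g F φ i * calibrationEval g F φ (n - i)
      = if n = 0 then 1 else 0 := by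
  have := congrArg (fun M : Matrix ι ι (MvPowerSeries ι K) => M.map φ)
    (sum_inverseCoeff_mul hSE hTRR n)
  simp only [sum_map_matrix, Matrix.map_mul] at this
  refine this.trans ?_
  split_ifs <;> simp

theorem calibrationEval_add (hSE : StringEquation g i₀ F) (hTRR : TopologicalRecursion g F)
    (m k : ℕ) :
    calibrationEval g F φ (m + 1 + k)
      = ∑ l ∈ Finset.range (m + 1), (-1 : ℤ) ^ l • (calibrationEval g F φ (m - l)
          * g⁻¹.map (algebraMap K R) * (hessianMatrix F l k).map φ) := by
  rw [calibrationEval, calibrationCoeff_add hSE hTRR]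
  simp only [sum_map_matrix, map_zsmul_matrix, Matrix.map_mul, invGram_map]
  rfl

theorem omega_zMonomial_mulVec (hsymm : g.IsSymm) (f : Loop ι R) (k : ℕ) :
    (fun α => Omega g f (zMonomial α k)) = (-1 : ℤ) ^ (k + 1) •
      (g.map (algebraMap K R)).mulVec (zCoeff f (-((k + 1 : ℕ) : ℤ))) := by
  funext α
  rw [omega_zMonomial, Pi.smul_apply, zsmul_eq_mul]
  push_cast
  congr 1
  refine Finset.sum_congr rfl fun β _ => ?_
  rw [← hsymm.apply β α]
  rfl

theorem zCoeff_neg_eq (hg : IsUnit g.det) (hsymm : g.IsSymm) (f : Loop ι R) (k : ℕ) :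
    zCoeff f (-((k + 1 : ℕ) : ℤ)) = (-1 : ℤ) ^ (k + 1) •
      (g⁻¹.map (algebraMap K R)).mulVec (fun α => Omega g f (zMonomial α k)) := by
  rw [omega_zMonomial_mulVec hsymm, Matrix.mulVec_smul, Matrix.mulVec_mulVec, inv_map_mul_map hg,
    Matrix.one_mulVec, smul_smul, ← mul_pow]
  simp

/-- The H_- part of Sf has two sources, S acting on the old H_- part and the overflow of Sq. By
`calibrationEval_add` the overflow replaces p by p - W(τ)q. Since S is symplectic, the result is
transported by the transpose of S⁻¹. -/
theorem omega_seriesMatrix_mulVec (hg : IsUnit g.det) (hsymm : g.IsSymm)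
    (hSE : StringEquation g i₀ F) (hTRR : TopologicalRecursion g F) {f : Loop ι R}
    {t : ι × ℕ →₀ R} (hf : HasPosition i₀ f t) (a : ι × ℕ) :
    Omega g ((seriesMatrix (calibrationEval g F φ)).mulVec f) (zMonomial a.1 a.2)
      = (upperCol (inverseEval g F φ) a).sum fun i x => x * reducedMomentum F φ
          (dilatonShift i₀ t) (fun i => Omega g f (zMonomial i.1 i.2)) i := by
  obtain ⟨α, k⟩ := a
  set C := calibrationEval g F φ with hC
  set q := dilatonShift i₀ t with hq
  set G := g.map (algebraMap K R)
  set Gi := g⁻¹.map (algebraMap K R) with hGi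
  set P' : ι × ℕ → R := reducedMomentum F φ q fun i => Omega g f (zMonomial i.1 i.2) with hP'
  obtain ⟨L, hL⟩ := exists_forall_eq_zero q
  have hred : ∀ j, (fun β => P' (β, j)) = (fun β => Omega g f (zMonomial β j))
      - ∑ l ∈ Finset.range L, ((hessianMatrix F j l).map φ).mulVec fun β => q (β, l) := by
    intro j
    funext β
    rw [hP', reducedMomentum, sum_eq_sum_range hL (fun j' c => c * φ (smallHessian F (β, j) j'))
      fun i => zero_mul _, Pi.sub_apply, Finset.sum_apply]
    congr 1
    refine Finset.sum_congr rfl fun l _ => Finset.sum_congr rfl fun γ _ => mul_comm _ _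
  have hneg : zCoeff ((seriesMatrix C).mulVec f) (-((k + 1 : ℕ) : ℤ))
      = ∑ j ∈ Finset.range (k + 1), (-1 : ℤ) ^ (j + 1) •
          (C (k - j) * Gi).mulVec fun β => P' (β, j) := by
    -- The first k + 1 terms involve the H_- part of f and the remaining L terms involve q;
    -- reflecting the first range indexes it by the covector component j.
    rw [zCoeff_seriesMatrix_mulVec C f _ (k + 1 + L), Finset.sum_range_add,
      ← Finset.sum_range_reflect]
    · have h1 : ∀ j ∈ Finset.range (k + 1), (C (k + 1 - 1 - j)).mulVec
            (zCoeff f (-((k + 1 : ℕ) : ℤ) + ((k + 1 - 1 - j : ℕ) : ℤ)))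
          = (-1 : ℤ) ^ (j + 1) •
            (C (k - j) * Gi).mulVec (fun β => Omega g f (zMonomial β j)) := by
        intro j hj
        have hjk := Finset.mem_range.mp hj
        rw [show (-((k + 1 : ℕ) : ℤ) + ((k + 1 - 1 - j : ℕ) : ℤ)) = -((j + 1 : ℕ) : ℤ) by omega,
          zCoeff_neg_eq hg hsymm, Matrix.mulVec_smul, Matrix.mulVec_mulVec, Nat.add_sub_cancel]
      have h2 : ∀ l ∈ Finset.range L, (C (k + 1 + l)).mulVec
            (zCoeff f (-((k + 1 : ℕ) : ℤ) + ((k + 1 + l : ℕ) : ℤ)))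
          = ∑ j ∈ Finset.range (k + 1), (-1 : ℤ) ^ j • (C (k - j) * Gi).mulVec
              (((hessianMatrix F j l).map φ).mulVec fun β => q (β, l)) := by
        intro l _
        have hz : zCoeff f (-((k + 1 : ℕ) : ℤ) + ((k + 1 + l : ℕ) : ℤ)) = fun β => q (β, l) := by
          rw [show (-((k + 1 : ℕ) : ℤ) + ((k + 1 + l : ℕ) : ℤ)) = (l : ℤ) by push_cast; ring]
          exact funext fun β => hf β l
        rw [hz, hC, calibrationEval_add φ hSE hTRR, Matrix.sum_mulVec]
        refine Finset.sum_congr rfl fun j _ => ?_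
        rw [Matrix.smul_mulVec, Matrix.mulVec_mulVec]
      rw [Finset.sum_congr rfl h1, Finset.sum_congr rfl h2, Finset.sum_comm,
        ← Finset.sum_add_distrib]
      refine Finset.sum_congr rfl fun j _ => ?_
      rw [hred, Matrix.mulVec_sub, Matrix.mulVec_sum, smul_sub, ← Finset.smul_sum, pow_succ]
      simp only [mul_neg, mul_one, neg_smul]
      abel
    · intro m β hm
      obtain ⟨d, rfl⟩ := Nat.exists_eq_add_of_le hm
      rw [show (-((k + 1 : ℕ) : ℤ) + ((k + 1 + L + d : ℕ) : ℤ)) = ((L + d : ℕ) : ℤ) by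
        push_cast; ring, hf]
      exact hL _ _ (Nat.le_add_right _ _)
  have h := congrFun (omega_zMonomial_mulVec hsymm ((seriesMatrix C).mulVec f) k) α
  refine h.trans ?_
  rw [hneg, Matrix.mulVec_sum, Finset.smul_sum,
    upperCol_sum _ _ (fun i x => x * P' i) fun i => zero_mul _, Finset.sum_apply]
  refine Finset.sum_congr rfl fun j hj => ?_
  have hjk := Finset.mem_range.mp hj
  have hA : ∑ β, inverseEval g F φ (k - j) β α * P' (β, j)
      = (inverseEval g F φ (k - j)).transpose.mulVec (fun β => P' (β, j)) α := rfl
  rw [hA, inverseEval_transpose φ hg hsymm, Matrix.mulVec_smul, smul_smul, ← pow_add,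
    Matrix.mulVec_mulVec, Matrix.smul_mulVec, Matrix.mul_assoc,
    show k + 1 + (j + 1) = (k - j) + 2 * (j + 1) by omega, pow_add, pow_mul]
  simp [hC, hGi]

end Momentum

/-! ### The ancestor potential as a function of points -/

section Points

variable {ι K : Type*} [Fintype ι] [DecidableEq ι] [CommRing K] [Algebra ℚ K]
  {g : Matrix ι ι K} {i₀ : ι} {F : MvPowerSeries (ι × ℕ) K}

section Coordinates

variable {R : Type*} [CommRing R] [Algebra K R]

/-- The point `τ` of `H ⊂ H_+`. -/
def basePoint (φ : MvPowerSeries ι K →ₐ[K] R) : ι × ℕ →₀ R :=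
  ∑ α, Finsupp.single (α, 0) (φ (X α))

/-- The coordinates `t` on the cone of the point with coordinates `t̄` on its translate. -/
def descendantPoint (g : Matrix ι ι K) (F : MvPowerSeries (ι × ℕ) K)
    (φ : MvPowerSeries ι K →ₐ[K] R) (t : ι × ℕ →₀ R) : ι × ℕ →₀ R :=
  upper (inverseEval g F φ) t + basePoint φ

/-- The coordinates `t̄` on the translated cone of the point with coordinates `t` on the cone. -/
def ancestorPoint (g : Matrix ι ι K) (F : MvPowerSeries (ι × ℕ) K)
    (φ : MvPowerSeries ι K →ₐ[K] R) (t : ι × ℕ →₀ R) : ι × ℕ →₀ R :=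
  upper (calibrationEval g F φ) t - basePoint φ

theorem basePoint_zero (φ : MvPowerSeries ι K →ₐ[K] R) (α : ι) :
    basePoint φ (α, 0) = φ (X α) := by
  simp [basePoint, Finsupp.finsetSum_apply, Finsupp.single_apply, Finset.sum_ite_eq']

theorem basePoint_succ (φ : MvPowerSeries ι K →ₐ[K] R) (α : ι) (k : ℕ) :
    basePoint φ (α, k + 1) = 0 := by
  simp [basePoint, Finsupp.finsetSum_apply]

variable (φ : MvPowerSeries ι K →ₐ[K] R)

theorem inverseEval_zero : inverseEval g F φ 0 = 1 := by
  simp [inverseEval, inverseCoeff]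

theorem calibrationEval_zero : calibrationEval g F φ 0 = 1 := by
  simp [calibrationEval, calibrationCoeff]

theorem calibrationEval_one (hg : IsUnit g.det) (hsymm : g.IsSymm) (hSE : StringEquation g i₀ F)
    (α : ι) : calibrationEval g F φ 1 α i₀ = φ (X α) := by
  rw [calibrationEval, Matrix.map_apply, calibrationCoeff,
    invGram_mul_hessianMatrix_zero hg hsymm hSE]

theorem inverseEval_one (hg : IsUnit g.det) (hsymm : g.IsSymm) (hSE : StringEquation g i₀ F)
    (α : ι) : inverseEval g F φ 1 α i₀ = -φ (X α) := by
  rw [inverseEval, Matrix.map_apply, inverseCoeff, zero_add, pow_one, neg_smul, one_smul,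
    Matrix.neg_apply, invGram_mul_hessianMatrix_zero hg hsymm hSE, map_neg]

/-- The scalar `c` is 1 for S and -1 for S⁻¹, whose z⁻¹ coefficients send 1 to τ and -τ. -/
theorem upperCol_unit_one {C : ℕ → Matrix ι ι R} (hC : C 0 = 1) (c : R)
    (hC1 : ∀ α, C 1 α i₀ = c * φ (X α)) :
    upperCol C (i₀, 1) = Finsupp.single (i₀, 1) 1 + c • basePoint φ := by
  ext ⟨α, k⟩
  rw [upperCol_apply, Finsupp.add_apply, Finsupp.smul_apply, smul_eq_mul]
  match k with
  | 0 => rw [basePoint_zero, ← hC1]; simp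
  | 1 =>
    rw [basePoint_succ, Finsupp.single_apply]
    simp [hC, Matrix.one_apply, eq_comm]
  | k + 2 =>
    rw [basePoint_succ, Finsupp.single_apply]
    simp

/-- The added τ is [S⁻¹(-z)]_+ + z; thus the affine change of t is linear in q. -/
theorem dilatonShift_descendantPoint (hg : IsUnit g.det) (hsymm : g.IsSymm)
    (hSE : StringEquation g i₀ F) (t : ι × ℕ →₀ R) :
    dilatonShift i₀ (descendantPoint g F φ t)
      = upper (inverseEval g F φ) (dilatonShift i₀ t) := by
  rw [dilatonShift, dilatonShift, map_sub, upper_single,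
    upperCol_unit_one φ (inverseEval_zero φ) (-1) fun α => by
      rw [inverseEval_one φ hg hsymm hSE, neg_one_mul], descendantPoint, neg_one_smul]
  abel

theorem dilatonShift_ancestorPoint (hg : IsUnit g.det) (hsymm : g.IsSymm)
    (hSE : StringEquation g i₀ F) (t : ι × ℕ →₀ R) :
    dilatonShift i₀ (ancestorPoint g F φ t)
      = upper (calibrationEval g F φ) (dilatonShift i₀ t) := by
  rw [dilatonShift, dilatonShift, map_sub, upper_single,
    upperCol_unit_one φ (calibrationEval_zero φ) 1 fun α => by
      rw [calibrationEval_one φ hg hsymm hSE, one_mul], ancestorPoint, one_smul]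
  abel

theorem dilatonShift_injective :
    Function.Injective (dilatonShift i₀ : (ι × ℕ →₀ R) → ι × ℕ →₀ R) :=
  fun _ _ h => sub_left_injective h

theorem descendantPoint_ancestorPoint (hg : IsUnit g.det) (hsymm : g.IsSymm)
    (hSE : StringEquation g i₀ F) (hTRR : TopologicalRecursion g F) (t : ι × ℕ →₀ R) :
    descendantPoint g F φ (ancestorPoint g F φ t) = t := by
  apply dilatonShift_injective (i₀ := i₀)
  rw [dilatonShift_descendantPoint φ hg hsymm hSE, dilatonShift_ancestorPoint φ hg hsymm hSE,
    upper_upper (sum_inverseEval_mul φ hSE hTRR)]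

theorem ancestorPoint_descendantPoint (hg : IsUnit g.det) (hsymm : g.IsSymm)
    (hSE : StringEquation g i₀ F) (hTRR : TopologicalRecursion g F) (t : ι × ℕ →₀ R) :
    ancestorPoint g F φ (descendantPoint g F φ t) = t := by
  apply dilatonShift_injective (i₀ := i₀)
  rw [dilatonShift_ancestorPoint φ hg hsymm hSE, dilatonShift_descendantPoint φ hg hsymm hSE,
    upper_upper (sum_calibrationEval_mul φ hg hsymm hSE hTRR)]

end Coordinates

variable {Y : Type*} (φ : MvPowerSeries ι K →ₐ[K] MvPowerSeries Y K)

theorem infinitesimal_upper {C : ℕ → Matrix ι ι (MvPowerSeries Y K)}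
    {t : ι × ℕ →₀ MvPowerSeries Y K} (ht : Infinitesimal t) : Infinitesimal (upper C t) := by
  intro i
  rw [upper_apply, map_finsuppSum]
  refine Finset.sum_eq_zero fun a _ => ?_
  simp only [map_mul, ht a, zero_mul]

theorem infinitesimal_basePoint (hφ : Infinitesimal fun α => φ (X α)) :
    Infinitesimal (basePoint φ) := by
  rintro ⟨α, k⟩
  cases k with
  | zero => rw [basePoint_zero]; exact hφ α
  | succ k => rw [basePoint_succ, map_zero]

theorem infinitesimal_descendantPoint (hφ : Infinitesimal fun α => φ (X α))
    {t : ι × ℕ →₀ MvPowerSeries Y K} (ht : Infinitesimal t) :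
    Infinitesimal (descendantPoint g F φ t) := fun i => by
  rw [descendantPoint, Finsupp.add_apply, map_add, infinitesimal_upper ht i,
    infinitesimal_basePoint φ hφ i, add_zero]

theorem infinitesimal_ancestorPoint (hφ : Infinitesimal fun α => φ (X α))
    {t : ι × ℕ →₀ MvPowerSeries Y K} (ht : Infinitesimal t) :
    Infinitesimal (ancestorPoint g F φ t) := fun i => by
  rw [ancestorPoint, Finsupp.sub_apply, map_sub, infinitesimal_upper ht i,
    infinitesimal_basePoint φ hφ i, sub_zero]

/-- The quadratic form `∑ ∂_i ∂_j F(τ) q_i q_j`. -/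
def hessianForm (F : MvPowerSeries (ι × ℕ) K) {R : Type*} [CommRing R] [Algebra K R]
    (φ : MvPowerSeries ι K →ₐ[K] R) (q : ι × ℕ →₀ R) : R :=
  q.sum fun i c => c * q.sum fun j d => d * φ (smallHessian F i j)

/-- The value of the ancestor potential at `(τ, t̄)`. -/
def ancestorValue (g : Matrix ι ι K) (i₀ : ι) (F : MvPowerSeries (ι × ℕ) K)
    (φ : MvPowerSeries ι K →ₐ[K] MvPowerSeries Y K) (t : ι × ℕ →₀ MvPowerSeries Y K) :
    MvPowerSeries Y K :=
  subst (descendantPoint g F φ t) F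
    - (1 / 2 : ℚ) • hessianForm F φ (dilatonShift i₀ (descendantPoint g F φ t))

/-- The differential of the ancestor potential at `(τ, t̄)`. -/
def ancestorMomentum (g : Matrix ι ι K) (i₀ : ι) (F : MvPowerSeries (ι × ℕ) K)
    (φ : MvPowerSeries ι K →ₐ[K] MvPowerSeries Y K) (t : ι × ℕ →₀ MvPowerSeries Y K)
    (a : ι × ℕ) : MvPowerSeries Y K :=
  (upperCol (inverseEval g F φ) a).sum fun i x => x * reducedMomentum F φ
    (dilatonShift i₀ (descendantPoint g F φ t))
    (fun i => subst (descendantPoint g F φ t) (pderiv K i F)) i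

/-- `p̄(q̄) = 2 F̄` by homogeneity. -/
theorem sum_mul_ancestorMomentum (hg : IsUnit g.det) (hsymm : g.IsSymm)
    (hDE : DilatonEquation i₀ F) (hSE : StringEquation g i₀ F)
    (hφ : Infinitesimal fun α => φ (X α)) {t : ι × ℕ →₀ MvPowerSeries Y K}
    (ht : Infinitesimal t) :
    (dilatonShift i₀ t).sum (fun a c => ancestorMomentum g i₀ F φ t a * c)
      = (2 : ℚ) • ancestorValue g i₀ F φ t := by
  have hinf := infinitesimal_descendantPoint (g := g) (F := F) φ hφ ht
  have hE := hDE.sum_mul_subst_pderiv hinf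
  set u := descendantPoint g F φ t with hu
  have hq : dilatonShift i₀ u = upper (inverseEval g F φ) (dilatonShift i₀ t) :=
    dilatonShift_descendantPoint φ hg hsymm hSE t
  set P' := reducedMomentum F φ (dilatonShift i₀ u) (fun i => subst u (pderiv K i F)) with hP'
  -- Momentum transforms by the transpose of q̄ ↦ q, so the pairing may be computed before the
  -- translation.
  have h1 : (dilatonShift i₀ t).sum (fun a c => ancestorMomentum g i₀ F φ t a * c)
      = (dilatonShift i₀ u).sum fun i x => x * P' i := by
    rw [hq, upper, Finsupp.linearCombination_apply,
      Finsupp.sum_sum_index (fun i => zero_mul _) (fun i x y => add_mul _ _ _)]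
    refine Finset.sum_congr rfl fun a _ => ?_
    beta_reduce
    rw [Finsupp.sum_smul_index fun i => zero_mul (P' i), ancestorMomentum, Finsupp.sum_mul]
    refine Finset.sum_congr rfl fun i _ => ?_
    change _ * P' i * _ = _ * _ * P' i
    ring
  have h2 : ∀ i (x : MvPowerSeries Y K), x * P' i = x * subst u (pderiv K i F)
      - x * (dilatonShift i₀ u).sum fun j c => c * φ (smallHessian F i j) := fun i x => by
    rw [hP', reducedMomentum, mul_sub]
  rw [h1]
  simp only [h2]
  rw [Finsupp.sum_sub, hE, ancestorValue, smul_sub, smul_smul, ← hu, hessianForm]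
  norm_num

/-! ### Compatibility of the ancestor data with changes of parameters -/

section Naturality

variable {Z : Type*} (ψ : MvPowerSeries Y K →ₐ[K] MvPowerSeries Z K)

/-- The image of a point under a homomorphism. -/
def mapPoint (ψ : MvPowerSeries Y K →ₐ[K] MvPowerSeries Z K)
    (t : ι × ℕ →₀ MvPowerSeries Y K) : ι × ℕ →₀ MvPowerSeries Z K :=
  t.mapRange ψ (map_zero ψ)

theorem mapPoint_apply (t : ι × ℕ →₀ MvPowerSeries Y K) (i : ι × ℕ) :
    mapPoint ψ t i = ψ (t i) := rfl

theorem mapPoint_sum (t : ι × ℕ →₀ MvPowerSeries Y K) (f : ι × ℕ → MvPowerSeries Z K) :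
    ((mapPoint ψ t).sum fun i c => c * f i) = t.sum fun i c => ψ c * f i :=
  Finsupp.sum_mapRange_index fun _ => zero_mul _

theorem mapPoint_upperCol (a : ι × ℕ) :
    mapPoint ψ (upperCol (inverseEval g F φ) a)
      = upperCol (inverseEval g F (ψ.comp φ)) a := by
  ext1 i
  rw [mapPoint_apply, upperCol_apply, upperCol_apply]
  split_ifs
  · rfl
  · exact map_zero ψ

theorem mapPoint_descendantPoint (t : ι × ℕ →₀ MvPowerSeries Y K) :
    mapPoint ψ (descendantPoint g F φ t)
      = descendantPoint g F (ψ.comp φ) (mapPoint ψ t) := by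
  ext1 i
  rw [mapPoint_apply, descendantPoint, descendantPoint, Finsupp.add_apply, Finsupp.add_apply,
    map_add]
  congr 1
  · rw [upper_apply, upper_apply, mapPoint_sum, map_finsuppSum]
    refine Finset.sum_congr rfl fun a _ => ?_
    simp only [map_mul, ← mapPoint_upperCol, mapPoint_apply]
  · obtain ⟨α, k⟩ := i
    cases k with
    | zero => rw [basePoint_zero, basePoint_zero]; rfl
    | succ k => rw [basePoint_succ, basePoint_succ, map_zero]

theorem mapPoint_dilatonShift (t : ι × ℕ →₀ MvPowerSeries Y K) :
    mapPoint ψ (dilatonShift i₀ t) = dilatonShift i₀ (mapPoint ψ t) := by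
  ext1 i
  rw [mapPoint_apply, dilatonShift, dilatonShift, Finsupp.sub_apply, Finsupp.sub_apply, map_sub,
    mapPoint_apply, Finsupp.single_apply, Finsupp.single_apply]
  split_ifs <;> simp

theorem map_hessianForm (q : ι × ℕ →₀ MvPowerSeries Y K) :
    ψ (hessianForm F φ q) = hessianForm F (ψ.comp φ) (mapPoint ψ q) := by
  rw [hessianForm, hessianForm, mapPoint_sum, map_finsuppSum]
  refine Finset.sum_congr rfl fun i _ => ?_
  simp only [mapPoint_sum, map_mul, map_finsuppSum]
  rfl

theorem map_reducedMomentum (q : ι × ℕ →₀ MvPowerSeries Y K)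
    (p : ι × ℕ → MvPowerSeries Y K) (i : ι × ℕ) :
    ψ (reducedMomentum F φ q p i)
      = reducedMomentum F (ψ.comp φ) (mapPoint ψ q) (fun i => ψ (p i)) i := by
  rw [reducedMomentum, reducedMomentum, map_sub, mapPoint_sum, map_finsuppSum]
  simp only [map_mul]
  rfl

variable (hψ : ∀ (t : ι × ℕ →₀ MvPowerSeries Y K), Infinitesimal t → ∀ f : MvPowerSeries (ι × ℕ) K,
  ψ (subst t f) = subst (mapPoint ψ t) f) (hφ : Infinitesimal fun α => φ (X α))

-- An algebra homomorphism of power series rings need not respect infinite sums, so `hψ` asks that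
-- it commute with evaluation at infinitesimal points; the rest is polynomial in the coordinates.
include hψ hφ in
theorem map_ancestorValue {t : ι × ℕ →₀ MvPowerSeries Y K} (ht : Infinitesimal t) :
    ψ (ancestorValue g i₀ F φ t) = ancestorValue g i₀ F (ψ.comp φ) (mapPoint ψ t) := by
  rw [ancestorValue, ancestorValue, map_sub, hψ _ (infinitesimal_descendantPoint φ hφ ht),
    map_rat_smul, map_hessianForm, mapPoint_dilatonShift, mapPoint_descendantPoint]

include hψ hφ in
theorem map_ancestorMomentum {t : ι × ℕ →₀ MvPowerSeries Y K} (ht : Infinitesimal t)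
    (a : ι × ℕ) :
    ψ (ancestorMomentum g i₀ F φ t a)
      = ancestorMomentum g i₀ F (ψ.comp φ) (mapPoint ψ t) a := by
  rw [ancestorMomentum, ancestorMomentum, ← mapPoint_upperCol, mapPoint_sum,
    map_finsuppSum]
  refine Finset.sum_congr rfl fun i _ => ?_
  simp only [map_mul, map_reducedMomentum, mapPoint_dilatonShift, mapPoint_descendantPoint,
    hψ _ (infinitesimal_descendantPoint φ hφ ht)]

end Naturality

end Points

/-! ### Derivatives of the ancestor potential -/

section Derivatives

variable {ι K : Type*} [Fintype ι] [DecidableEq ι] [CommRing K] [Algebra ℚ K]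
  {g : Matrix ι ι K} {i₀ : ι} {F : MvPowerSeries (ι × ℕ) K} {Y : Type*}

theorem pderiv_sum_mul (y : Y) {q w : ι × ℕ →₀ MvPowerSeries Y K}
    (hq : ∀ i, pderiv K y (q i) = w i) {v e : ι × ℕ → MvPowerSeries Y K}
    (hv : ∀ i, pderiv K y (v i) = e i) :
    pderiv K y (q.sum fun i c => c * v i)
      = (w.sum fun i x => x * v i) + q.sum fun i c => c * e i := by
  have h0 : ∀ f : ι × ℕ → MvPowerSeries Y K, ∀ i ∈ q.support ∪ w.support,
      (fun i c => c * f i) i (0 : MvPowerSeries Y K) = 0 := fun f i _ => zero_mul _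
  rw [Finsupp.sum_of_support_subset q Finset.subset_union_left _ (h0 v),
    Finsupp.sum_of_support_subset w Finset.subset_union_right _ (h0 v),
    Finsupp.sum_of_support_subset q Finset.subset_union_left _ (h0 e), map_sum,
    ← Finset.sum_add_distrib]
  refine Finset.sum_congr rfl fun i _ => ?_
  rw [Derivation.leibniz, hq, hv, smul_eq_mul, smul_eq_mul]
  ring

theorem pderiv_subst_point (y : Y) {u w : ι × ℕ →₀ MvPowerSeries Y K} (hu : Infinitesimal u)
    (hw : ∀ i, pderiv K y (u i) = w i) (f : MvPowerSeries (ι × ℕ) K) :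
    pderiv K y (subst u f) = w.sum fun i x => x * subst u (pderiv K i f) := by
  rw [pderiv_subst (hasSubst_of_finsupp hu) y w.support fun i hi => by
    rw [hw, Finsupp.notMem_support_iff.mp hi]]
  exact Finset.sum_congr rfl fun i _ => by rw [hw]

/-- The second derivatives of the ancestor potential at `(τ, t̄)`. -/
def ancestorHessian (g : Matrix ι ι K) (F : MvPowerSeries (ι × ℕ) K)
    (φ : MvPowerSeries ι K →ₐ[K] MvPowerSeries Y K) (t : ι × ℕ →₀ MvPowerSeries Y K)
    (a b : ι × ℕ) : MvPowerSeries Y K :=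
  (upperCol (inverseEval g F φ) a).sum fun i x => x *
    (upperCol (inverseEval g F φ) b).sum fun j y => y *
      (subst (descendantPoint g F φ t) (pderiv K j (pderiv K i F)) - φ (smallHessian F i j))

/-- The third derivatives of `F` contracted twice with the differential of `t̄ ↦ t`. -/
def ancestorContraction (g : Matrix ι ι K) (F : MvPowerSeries (ι × ℕ) K)
    (φ : MvPowerSeries ι K →ₐ[K] MvPowerSeries Y K) (t : ι × ℕ →₀ MvPowerSeries Y K)
    (b c i : ι × ℕ) : MvPowerSeries Y K :=
  (upperCol (inverseEval g F φ) b).sum fun j y => y *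
    (upperCol (inverseEval g F φ) c).sum fun k z => z *
      subst (descendantPoint g F φ t) (pderiv K k (pderiv K j (pderiv K i F)))

/-- The third derivatives of the ancestor potential at `(τ, t̄)`. -/
def ancestorThird (g : Matrix ι ι K) (F : MvPowerSeries (ι × ℕ) K)
    (φ : MvPowerSeries ι K →ₐ[K] MvPowerSeries Y K) (t : ι × ℕ →₀ MvPowerSeries Y K)
    (a b c : ι × ℕ) : MvPowerSeries Y K :=
  (upperCol (inverseEval g F φ) a).sum fun i x => x * ancestorContraction g F φ t b c i

/-! ### Derivatives along one coordinate of t̄ with τ fixed -/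

section Direction

variable {φ : MvPowerSeries ι K →ₐ[K] MvPowerSeries Y K} (hφ : Infinitesimal fun α => φ (X α))
  {t : ι × ℕ →₀ MvPowerSeries Y K} (ht : Infinitesimal t) {y : Y}
  (hφy : ∀ x, pderiv K y (φ x) = 0) {a : ι × ℕ}
  (hty : ∀ i, pderiv K y (t i) = Finsupp.single a (1 : MvPowerSeries Y K) i)

include hφy in
theorem pderiv_upperCol_sum (b : ι × ℕ) (v : ι × ℕ → MvPowerSeries Y K) :
    pderiv K y ((upperCol (inverseEval g F φ) b).sum fun i x => x * v i)
      = (upperCol (inverseEval g F φ) b).sum fun i x => x * pderiv K y (v i) := by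
  rw [pderiv_sum_mul y (w := 0) (e := fun i => pderiv K y (v i)) _ fun _ => rfl,
    Finsupp.sum_zero_index, zero_add]
  intro i
  rw [upperCol_apply]
  split_ifs
  · exact hφy _
  · exact map_zero _

include hφy hty in
theorem pderiv_descendantPoint (i : ι × ℕ) :
    pderiv K y (descendantPoint g F φ t i) = upperCol (inverseEval g F φ) a i := by
  have h0 : pderiv K y (basePoint φ i) = 0 := by
    obtain ⟨α, k⟩ := i
    cases k with
    | zero => rw [basePoint_zero, hφy]
    | succ k => rw [basePoint_succ, map_zero]
  rw [descendantPoint, Finsupp.add_apply, map_add, h0, add_zero, upper_apply,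
    pderiv_sum_mul y hty (e := 0) _, Finsupp.sum_single_index (zero_mul _), one_mul]
  · simp
  · intro b
    rw [upperCol_apply]
    split_ifs
    · exact hφy _
    · exact map_zero _

include hφy hty in
theorem pderiv_dilatonShift_descendantPoint (i : ι × ℕ) :
    pderiv K y (dilatonShift i₀ (descendantPoint g F φ t) i)
      = upperCol (inverseEval g F φ) a i := by
  rw [dilatonShift, Finsupp.sub_apply, map_sub, pderiv_descendantPoint hφy hty,
    Finsupp.single_apply]
  split_ifs
  · rw [Derivation.map_one_eq_zero, sub_zero]
  · rw [map_zero, sub_zero]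

include hφy in
theorem pderiv_hessianForm {q w : ι × ℕ →₀ MvPowerSeries Y K}
    (hq : ∀ i, pderiv K y (q i) = w i) :
    pderiv K y (hessianForm F φ q)
      = (2 : ℚ) • w.sum fun i x => x * q.sum fun j d => d * φ (smallHessian F i j) := by
  have hin : ∀ i, pderiv K y (q.sum fun j d => d * φ (smallHessian F i j))
      = w.sum fun j x => x * φ (smallHessian F i j) := fun i => by
    rw [pderiv_sum_mul y hq fun j => hφy (smallHessian F i j)]
    simp
  rw [hessianForm, pderiv_sum_mul y hq hin, two_smul]
  congr 1
  simp only [Finsupp.sum, Finset.mul_sum]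
  rw [Finset.sum_comm]
  refine Finset.sum_congr rfl fun i _ => Finset.sum_congr rfl fun j _ => ?_
  rw [smallHessian_comm]
  ring

include hφ ht hφy hty

/-- Differentiating F(t) - W(τ)(q,q)/2 in t̄ produces p - W(τ)q contracted with the column of S⁻¹
that is the derivative of t: exactly the momentum of the translated cone. -/
theorem pderiv_ancestorValue :
    pderiv K y (ancestorValue g i₀ F φ t) = ancestorMomentum g i₀ F φ t a := by
  rw [ancestorValue, map_sub, map_rat_smul,
    pderiv_subst_point y (infinitesimal_descendantPoint φ hφ ht) (pderiv_descendantPoint hφy hty),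
    pderiv_hessianForm hφy (pderiv_dilatonShift_descendantPoint hφy hty), smul_smul,
    ancestorMomentum]
  norm_num
  rw [← Finsupp.sum_sub]
  refine Finset.sum_congr rfl fun i _ => ?_
  beta_reduce
  rw [reducedMomentum, mul_sub]

theorem pderiv_ancestorMomentum (b : ι × ℕ) :
    pderiv K y (ancestorMomentum g i₀ F φ t b) = ancestorHessian g F φ t b a := by
  rw [ancestorMomentum, pderiv_upperCol_sum hφy, ancestorHessian]
  refine Finset.sum_congr rfl fun i _ => ?_
  beta_reduce
  congr 1
  rw [reducedMomentum, map_sub,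
    pderiv_subst_point y (infinitesimal_descendantPoint φ hφ ht) (pderiv_descendantPoint hφy hty),
    pderiv_sum_mul y (pderiv_dilatonShift_descendantPoint hφy hty)
      fun j => hφy (smallHessian F i j)]
  simp only [mul_zero, Finsupp.sum_fun_zero, add_zero, mul_sub, Finsupp.sum_sub]

theorem pderiv_ancestorHessian (b c : ι × ℕ) :
    pderiv K y (ancestorHessian g F φ t b c) = ancestorThird g F φ t b c a := by
  rw [ancestorHessian, pderiv_upperCol_sum hφy, ancestorThird]
  refine Finset.sum_congr rfl fun i _ => ?_
  beta_reduce
  rw [pderiv_upperCol_sum hφy, ancestorContraction]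
  congr 1
  refine Finset.sum_congr rfl fun j _ => ?_
  beta_reduce
  rw [map_sub, hφy, sub_zero,
    pderiv_subst_point y (infinitesimal_descendantPoint φ hφ ht) (pderiv_descendantPoint hφy hty)]

end Direction

theorem map_ancestorHessian {Z : Type*} (φ : MvPowerSeries ι K →ₐ[K] MvPowerSeries Y K)
    (ψ : MvPowerSeries Y K →ₐ[K] MvPowerSeries Z K)
    (hψ : ∀ (t : ι × ℕ →₀ MvPowerSeries Y K), Infinitesimal t →
      ∀ f : MvPowerSeries (ι × ℕ) K, ψ (subst t f) = subst (mapPoint ψ t) f)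
    (hφ : Infinitesimal fun α => φ (X α)) {t : ι × ℕ →₀ MvPowerSeries Y K} (ht : Infinitesimal t)
    (a b : ι × ℕ) :
    ψ (ancestorHessian g F φ t a b) = ancestorHessian g F (ψ.comp φ) (mapPoint ψ t) a b := by
  simp only [ancestorHessian, ← mapPoint_upperCol, mapPoint_sum, map_finsuppSum, map_mul, map_sub,
    hψ _ (infinitesimal_descendantPoint φ hφ ht), mapPoint_descendantPoint, AlgHom.comp_apply]

/-! ### Topological recursion for the ancestor potential -/

section Recursion

variable (φ : MvPowerSeries ι K →ₐ[K] MvPowerSeries Y K) (t : ι × ℕ →₀ MvPowerSeries Y K)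

theorem ancestorThird_zero (ν : ι) (b c : ι × ℕ) :
    ancestorThird g F φ t (ν, 0) b c = ancestorContraction g F φ t b c (ν, 0) := by
  rw [ancestorThird, upperCol_zero (inverseEval_zero φ), Finsupp.sum_single_index (zero_mul _),
    one_mul]

theorem ancestorHessian_zero (a : ι × ℕ) (μ : ι) :
    ancestorHessian g F φ t a (μ, 0)
      = (upperCol (inverseEval g F φ) a).sum fun i x => x *
        (subst (descendantPoint g F φ t) (pderiv K (μ, 0) (pderiv K i F))
          - φ (smallHessian F i (μ, 0))) := by
  rw [ancestorHessian, upperCol_zero (inverseEval_zero φ)]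
  simp

variable {φ t}

theorem ancestorContraction_succ (hTRR : TopologicalRecursion g F)
    (hinf : Infinitesimal (descendantPoint g F φ t)) (b c : ι × ℕ) (β : ι) (l : ℕ) :
    ancestorContraction g F φ t b c (β, l + 1) = ∑ μ, ∑ ν, g⁻¹ μ ν •
      (subst (descendantPoint g F φ t) (pderiv K (μ, 0) (pderiv K (β, l) F))
        * ancestorContraction g F φ t b c (ν, 0)) := by
  have hs := hasSubst_of_finsupp hinf
  simp only [ancestorContraction]
  set u := descendantPoint g F φ t
  have h : ∀ j k, subst u (pderiv K k (pderiv K j (pderiv K (β, l + 1) F)))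
      = ∑ μ, ∑ ν, g⁻¹ μ ν • (subst u (pderiv K (μ, 0) (pderiv K (β, l) F))
          * subst u (pderiv K k (pderiv K j (pderiv K (ν, 0) F)))) := by
    intro j k
    rw [pderiv_comm j, pderiv_comm k, hTRR β k.1 j.1 l k.2 j.2]
    simp only [← substAlgHom_apply (R := K) hs, map_sum, map_smul, map_mul]
    refine Finset.sum_congr rfl fun μ _ => Finset.sum_congr rfl fun ν _ => ?_
    rw [pderiv_comm (β, l), pderiv_comm j, pderiv_comm k (ν, 0)]
  simp only [h, Finsupp.sum, Finset.mul_sum, Algebra.smul_def]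
  rw [Finset.sum_congr rfl fun (j : ι × ℕ) _ => Finset.sum_comm, Finset.sum_comm]
  refine Finset.sum_congr rfl fun μ _ => ?_
  rw [Finset.sum_congr rfl fun (j : ι × ℕ) _ => Finset.sum_comm, Finset.sum_comm]
  refine Finset.sum_congr rfl fun ν _ => Finset.sum_congr rfl fun j _ =>
    Finset.sum_congr rfl fun k _ => ?_
  ring

/-- The degree k + 1 part of S S⁻¹ = 1, solved for its top term. It writes the z^0 entry of S⁻¹ φ_α
z^{k+1} through W(τ), the correction needed in `ancestorThird_succ`. -/
theorem inverseEval_succ (hg : IsUnit g.det) (hsymm : g.IsSymm) (hSE : StringEquation g i₀ F)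
    (hTRR : TopologicalRecursion g F) (k : ℕ) (ν α : ι) :
    inverseEval g F φ (k + 1) ν α = -∑ l ∈ Finset.range (k + 1), ∑ β, ∑ μ,
      algebraMap K _ (g⁻¹ μ ν) * φ (smallHessian F (β, l) (μ, 0))
        * inverseEval g F φ (k - l) β α := by
  have h := congrFun (congrFun (sum_calibrationEval_mul φ hg hsymm hSE hTRR (k + 1)) ν) α
  rw [Finset.sum_range_succ', if_neg (Nat.succ_ne_zero k), calibrationEval_zero, Matrix.one_mul,
    Nat.sub_zero, Matrix.add_apply, Matrix.sum_apply, Matrix.zero_apply, add_comm] at h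
  rw [eq_neg_of_add_eq_zero_left h]
  congr 1
  refine Finset.sum_congr rfl fun l _ => ?_
  rw [Nat.succ_sub_succ, Matrix.mul_apply]
  refine Finset.sum_congr rfl fun β _ => ?_
  rw [calibrationEval, Matrix.map_apply, calibrationCoeff, Matrix.mul_apply, map_sum,
    Finset.sum_mul]
  refine Finset.sum_congr rfl fun μ _ => ?_
  rw [map_mul, invGram, Matrix.map_apply, AlgHom.commutes, (inv_isSymm hsymm).apply,
    smallHessian_comm]
  rfl

/-- The topological recursion relations for the ancestor potential. -/
theorem ancestorThird_succ (hg : IsUnit g.det) (hsymm : g.IsSymm) (hSE : StringEquation g i₀ F)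
    (hTRR : TopologicalRecursion g F) (hinf : Infinitesimal (descendantPoint g F φ t))
    (α : ι) (k : ℕ) (b c : ι × ℕ) :
    ancestorThird g F φ t (α, k + 1) b c = ∑ μ, ∑ ν, g⁻¹ μ ν •
      (ancestorHessian g F φ t (α, k) (μ, 0) * ancestorThird g F φ t (ν, 0) b c) := by
  set h := ancestorContraction g F φ t b c with hh
  set A := inverseEval g F φ with hA
  -- The column of φ_α z^{k+1} is the column of φ_α z^k multiplied by z, plus a new z^0 entry.
  have hL : ancestorThird g F φ t (α, k + 1) b c
      = (∑ l ∈ Finset.range (k + 1), ∑ β, A (k - l) β α * h (β, l + 1))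
        + ∑ ν, A (k + 1) ν α * h (ν, 0) := by
    rw [ancestorThird, upperCol_sum _ _ (fun i x => x * h i) fun _ => zero_mul _,
      Finset.sum_range_succ']
    congr 1
    refine Finset.sum_congr rfl fun l _ => ?_
    simp only [Nat.succ_sub_succ]
    rfl
  have h1 : ∀ β l, h (β, l + 1) = ∑ ν, ∑ μ, algebraMap K _ (g⁻¹ μ ν)
      * subst (descendantPoint g F φ t) (pderiv K (μ, 0) (pderiv K (β, l) F)) * h (ν, 0) := by
    intro β l
    rw [hh, ancestorContraction_succ hTRR hinf, Finset.sum_comm]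
    simp only [Algebra.smul_def, mul_assoc]
  have hR : ∀ μ ν, g⁻¹ μ ν • (ancestorHessian g F φ t (α, k) (μ, 0)
        * ancestorThird g F φ t (ν, 0) b c)
      = ∑ l ∈ Finset.range (k + 1), ∑ β, A (k - l) β α * (algebraMap K _ (g⁻¹ μ ν)
          * (subst (descendantPoint g F φ t) (pderiv K (μ, 0) (pderiv K (β, l) F))
            - φ (smallHessian F (β, l) (μ, 0))) * h (ν, 0)) := by
    intro μ ν
    rw [ancestorHessian_zero, ancestorThird_zero, ← hh, ← hA, Algebra.smul_def,
      upperCol_sum _ _ (fun i x => x * (subst (descendantPoint g F φ t)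
        (pderiv K (μ, 0) (pderiv K i F)) - φ (smallHessian F i (μ, 0)))) fun _ => zero_mul _,
      Finset.sum_mul, Finset.mul_sum]
    refine Finset.sum_congr rfl fun l _ => ?_
    rw [Finset.sum_mul, Finset.mul_sum]
    refine Finset.sum_congr rfl fun β _ => ?_
    ring
  -- TRR for F applied to the shifted part gives ∂∂F(t); the new entry contributes -W(τ). Together
  -- they form the ancestor Hessian.
  have h2 : ∑ ν, A (k + 1) ν α * h (ν, 0) = -∑ l ∈ Finset.range (k + 1), ∑ β, ∑ ν, ∑ μ,
      A (k - l) β α * (algebraMap K _ (g⁻¹ μ ν) * φ (smallHessian F (β, l) (μ, 0)) * h (ν, 0)) := by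
    simp only [hA, inverseEval_succ hg hsymm hSE hTRR k, neg_mul, Finset.sum_neg_distrib,
      Finset.sum_mul]
    congr 1
    rw [Finset.sum_comm]
    refine Finset.sum_congr rfl fun l _ => ?_
    rw [Finset.sum_comm]
    refine Finset.sum_congr rfl fun β _ => Finset.sum_congr rfl fun ν _ =>
      Finset.sum_congr rfl fun μ _ => ?_
    ring
  have h3 : ∑ μ, ∑ ν, g⁻¹ μ ν • (ancestorHessian g F φ t (α, k) (μ, 0)
        * ancestorThird g F φ t (ν, 0) b c)
      = ∑ l ∈ Finset.range (k + 1), ∑ β, ∑ ν, ∑ μ, A (k - l) β α * (algebraMap K _ (g⁻¹ μ ν)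
          * (subst (descendantPoint g F φ t) (pderiv K (μ, 0) (pderiv K (β, l) F))
            - φ (smallHessian F (β, l) (μ, 0))) * h (ν, 0)) := by
    simp only [hR]
    rw [Finset.sum_comm, Finset.sum_congr rfl fun ν _ => Finset.sum_comm, Finset.sum_comm]
    refine Finset.sum_congr rfl fun l _ => ?_
    rw [Finset.sum_congr rfl fun ν _ => Finset.sum_comm, Finset.sum_comm]
  rw [hL, h2, h3, ← sub_eq_add_neg, ← Finset.sum_sub_distrib]
  refine Finset.sum_congr rfl fun l _ => ?_
  rw [← Finset.sum_sub_distrib]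
  refine Finset.sum_congr rfl fun β _ => ?_
  rw [h1, Finset.mul_sum, ← Finset.sum_sub_distrib]
  refine Finset.sum_congr rfl fun ν _ => ?_
  rw [Finset.mul_sum, ← Finset.sum_sub_distrib]
  refine Finset.sum_congr rfl fun μ _ => ?_
  ring

end Recursion

end Derivatives

/-! ### Existence and uniqueness of the ancestor potential -/

section Ancestor

variable {ι : Type u} [Fintype ι] [DecidableEq ι] {K : Type v} [CommRing K] [Algebra ℚ K]
  {g : Matrix ι ι K} {i₀ : ι} {F : MvPowerSeries (ι × ℕ) K} {Y : Type*}

section Evaluation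

/-- Evaluation of formal functions of `τ`. -/
def evalAt {τ : ι → MvPowerSeries Y K} (hτ : Infinitesimal τ) :
    MvPowerSeries ι K →ₐ[K] MvPowerSeries Y K :=
  substAlgHom (hasSubst_of_finite hτ)

theorem evalAt_X {τ : ι → MvPowerSeries Y K} (hτ : Infinitesimal τ) (α : ι) :
    evalAt hτ (X α) = τ α := by
  rw [evalAt, substAlgHom_X]

theorem infinitesimal_evalAt {τ : ι → MvPowerSeries Y K} (hτ : Infinitesimal τ) :
    Infinitesimal fun α => evalAt hτ (X α) := fun α => by
  beta_reduce
  rw [evalAt_X]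
  exact hτ α

theorem subst_basePoint {τ : ι → MvPowerSeries Y K} (hτ : Infinitesimal τ)
    (f : MvPowerSeries (ι × ℕ) K) : subst (basePoint (evalAt hτ)) f = evalAt hτ (smallHom f) := by
  rw [← smallPhase_eq, smallPhase, evalAt, substAlgHom_apply,
    subst_comp_subst_apply (hasSubst_of_finsupp infinitesimal_smallPoint) (hasSubst_of_finite hτ)]
  congr 1
  funext i
  obtain ⟨α, k⟩ := i
  cases k with
  | zero =>
    rw [basePoint_zero, substAlgHom_apply, smallPoint_zero]
  | succ k =>
    rw [basePoint_succ, smallPoint_succ, ← substAlgHom_apply (R := K) (hasSubst_of_finite hτ),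
      map_zero]

theorem hasSubst_elim {τ : ι → MvPowerSeries Y K} (hτ : Infinitesimal τ)
    {t : ι × ℕ →₀ MvPowerSeries Y K} (ht : Infinitesimal t) :
    HasSubst (Sum.elim τ t) where
  const_coeff s := by
    rcases s with s | s
    · exact (hasSubst_of_finite hτ).const_coeff s
    · exact (hasSubst_of_finsupp ht).const_coeff s
  coeff_zero d := by
    refine (((hasSubst_of_finite hτ).coeff_zero d).image Sum.inl).union
      (((hasSubst_of_finsupp ht).coeff_zero d).image Sum.inr) |>.subset ?_
    rintro (s | s) hs
    · exact Or.inl ⟨s, hs, rfl⟩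
    · exact Or.inr ⟨s, hs, rfl⟩

theorem infinitesimal_X_inl :
    Infinitesimal fun α => (X (Sum.inl α) : MvPowerSeries (ι ⊕ ι × ℕ) K) :=
  fun _ => constantCoeff_X _

/-- The point with `t̄_k^α` independent variables for `k < N` and zero otherwise. -/
def universalPoint (N : ℕ) : ι × ℕ →₀ MvPowerSeries (ι ⊕ ι × ℕ) K :=
  Finsupp.onFinset (Finset.univ ×ˢ Finset.range N)
    (fun a => if a.2 < N then X (Sum.inr a) else 0)
    (fun a ha => by
      have : a.2 < N := by
        by_contra h
        exact ha (if_neg h)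
      simpa using this)

theorem universalPoint_apply (N : ℕ) (a : ι × ℕ) :
    (universalPoint N : ι × ℕ →₀ MvPowerSeries (ι ⊕ ι × ℕ) K) a
      = if a.2 < N then X (Sum.inr a) else 0 := rfl

theorem infinitesimal_universalPoint (N : ℕ) :
    Infinitesimal (universalPoint N : ι × ℕ →₀ MvPowerSeries (ι ⊕ ι × ℕ) K) := fun a => by
  rw [universalPoint_apply]
  split_ifs
  · exact constantCoeff_X _
  · exact map_zero _

/-- The variables `τ^α` and `t̄_k^α` with `k < N`. -/
def levelBelow (N : ℕ) : ι ⊕ ι × ℕ → Prop := Sum.elim (fun _ => True) fun a => a.2 < N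

instance (N : ℕ) : DecidablePred (levelBelow N : ι ⊕ ι × ℕ → Prop) := fun i => by
  rcases i with i | i
  · exact inferInstanceAs (Decidable True)
  · exact inferInstanceAs (Decidable (i.2 < N))

theorem exists_levelBelow (d : ι ⊕ ι × ℕ →₀ ℕ) :
    ∃ N, ∀ n ≥ N, ∀ i ∈ d.support, levelBelow n i := by
  refine ⟨d.support.sup (Sum.elim (fun _ => 0) fun a => a.2) + 1, fun n hn i hi => ?_⟩
  rcases i with i | i
  · trivial
  · have := Finset.le_sup (f := Sum.elim (fun _ => 0) fun a : ι × ℕ => a.2) hi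
    exact lt_of_lt_of_le (Nat.lt_succ_of_le this) hn

theorem restrictVars_levelBelow (N : ℕ) (f : MvPowerSeries (ι ⊕ ι × ℕ) K) :
    restrictVars (levelBelow N) f
      = subst (Sum.elim (fun α => X (Sum.inl α)) (universalPoint N)) f := by
  rw [restrictVars_eq_subst]
  congr 1
  funext i
  rcases i with i | i
  · exact if_pos trivial
  · rfl

theorem subst_elim_restrictVars {τ : ι → MvPowerSeries Y K} (hτ : Infinitesimal τ)
    {t : ι × ℕ →₀ MvPowerSeries Y K} (ht : Infinitesimal t) {N : ℕ}
    (hN : ∀ α k, N ≤ k → t (α, k) = 0) (f : MvPowerSeries (ι ⊕ ι × ℕ) K) :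
    subst (Sum.elim τ t) (restrictVars (levelBelow N) f) = subst (Sum.elim τ t) f := by
  have hs := hasSubst_elim hτ ht
  rw [restrictVars_eq_subst, subst_comp_subst_apply (hasSubst_restrict _) hs]
  congr 1
  funext i
  split_ifs with h
  · rw [subst_X hs]
  · rcases i with i | i
    · exact absurd trivial h
    · rw [← substAlgHom_apply (R := K) hs, map_zero]
      exact (hN i.1 i.2 (not_lt.mp h)).symm

theorem substAlgHom_subst_point {Z : Type*} {a : Y → MvPowerSeries Z K} (ha : HasSubst a)
    (t : ι × ℕ →₀ MvPowerSeries Y K) (ht : Infinitesimal t) (f : MvPowerSeries (ι × ℕ) K) :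
    substAlgHom (R := K) ha (subst t f) = subst (mapPoint (substAlgHom ha) t) f := by
  rw [substAlgHom_apply, subst_comp_subst_apply (hasSubst_of_finsupp ht) ha]
  congr 1
  funext i
  rw [mapPoint_apply, substAlgHom_apply]

theorem substAlgHom_comp_evalAt {τ : ι → MvPowerSeries Y K} (hτ : Infinitesimal τ)
    {t : ι × ℕ →₀ MvPowerSeries Y K} (ht : Infinitesimal t) :
    (substAlgHom (R := K) (hasSubst_elim hτ ht)).comp (evalAt infinitesimal_X_inl)
      = evalAt hτ := by
  ext1 x
  rw [AlgHom.comp_apply, evalAt, evalAt, substAlgHom_apply, substAlgHom_apply, substAlgHom_apply,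
    subst_comp_subst_apply (hasSubst_of_finite infinitesimal_X_inl) (hasSubst_elim hτ ht)]
  congr 1
  funext α
  rw [subst_X (hasSubst_elim hτ ht), Sum.elim_inl]

theorem mapPoint_universalPoint {τ : ι → MvPowerSeries Y K} (hτ : Infinitesimal τ)
    {t : ι × ℕ →₀ MvPowerSeries Y K} (ht : Infinitesimal t) (N : ℕ) (i : ι × ℕ) :
    mapPoint (substAlgHom (R := K) (hasSubst_elim hτ ht)) (universalPoint N) i
      = if i.2 < N then t i else 0 := by
  rw [mapPoint_apply, universalPoint_apply]
  split_ifs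
  · rw [substAlgHom_X, Sum.elim_inr]
  · exact map_zero _

theorem mapPoint_universalPoint_eq {τ : ι → MvPowerSeries Y K} (hτ : Infinitesimal τ)
    {t : ι × ℕ →₀ MvPowerSeries Y K} (ht : Infinitesimal t) {N : ℕ}
    (hN : ∀ α k, N ≤ k → t (α, k) = 0) :
    mapPoint (substAlgHom (R := K) (hasSubst_elim hτ ht)) (universalPoint N) = t := by
  ext1 i
  rw [mapPoint_universalPoint hτ ht]
  split_ifs with h
  · rfl
  · exact (hN i.1 i.2 (not_lt.mp h)).symm

theorem pderiv_evalAt_inl (a : ι × ℕ) (x : MvPowerSeries ι K) :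
    pderiv K (Sum.inr a) (evalAt (infinitesimal_X_inl (ι := ι) (K := K)) x) = 0 := by
  rw [evalAt, substAlgHom_apply]
  exact pderiv_subst_eq_zero (hasSubst_of_finite infinitesimal_X_inl) _
    (fun i => pderiv_X_of_ne (by simp)) x

theorem pderiv_universalPoint {N : ℕ} {a : ι × ℕ} (ha : a.2 < N) (i : ι × ℕ) :
    pderiv K (Sum.inr a) ((universalPoint N : ι × ℕ →₀ MvPowerSeries (ι ⊕ ι × ℕ) K) i)
      = Finsupp.single a (1 : MvPowerSeries (ι ⊕ ι × ℕ) K) i := by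
  rw [universalPoint_apply, Finsupp.single_apply]
  by_cases h : a = i
  · rw [if_pos h, ← h, if_pos ha, pderiv_X_self]
  · rw [if_neg h]
    split_ifs
    · exact pderiv_X_of_ne (by simpa using Ne.symm h)
    · exact map_zero _

end Evaluation

/-- `G` restricts to the ancestor potential on the universal points. -/
def RestrictsToAncestor (g : Matrix ι ι K) (i₀ : ι) (F : MvPowerSeries (ι × ℕ) K)
    (G : MvPowerSeries (ι ⊕ ι × ℕ) K) : Prop :=
  ∀ N, restrictVars (levelBelow N) G
    = ancestorValue g i₀ F (evalAt infinitesimal_X_inl) (universalPoint N)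

/-- By naturality the value at the universal point of level n specialises to the one of level m ≤ n,
so the values glue. -/
theorem exists_restrictsToAncestor (g : Matrix ι ι K) (i₀ : ι) (F : MvPowerSeries (ι × ℕ) K) :
    ∃ G, RestrictsToAncestor g i₀ F G := by
  refine exists_restrictVars_eq exists_levelBelow _ fun m n hmn => ?_
  rw [restrictVars_levelBelow, ← substAlgHom_apply (R := K)
    (hasSubst_elim infinitesimal_X_inl (infinitesimal_universalPoint m)),
    map_ancestorValue _ _ (substAlgHom_subst_point _) (infinitesimal_evalAt _)
      (infinitesimal_universalPoint n),
    substAlgHom_comp_evalAt infinitesimal_X_inl (infinitesimal_universalPoint m)]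
  congr 1
  ext1 i
  rw [mapPoint_universalPoint infinitesimal_X_inl (infinitesimal_universalPoint m),
    universalPoint_apply]
  by_cases h : i.2 < m
  · rw [if_pos (h.trans_le hmn)]
  · rw [if_neg h, ite_self]

/-! ### From universal points to arbitrary points -/

section Restricts

variable {G : MvPowerSeries (ι ⊕ ι × ℕ) K} (hG : RestrictsToAncestor g i₀ F G)

include hG

theorem RestrictsToAncestor.pderiv {N : ℕ} {a : ι × ℕ} (ha : a.2 < N) :
    restrictVars (levelBelow N) (pderiv K (Sum.inr a) G)
      = ancestorMomentum g i₀ F (evalAt infinitesimal_X_inl) (universalPoint N) a := by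
  rw [← pderiv_restrictVars _ (show levelBelow N (Sum.inr a) from ha), hG N,
    pderiv_ancestorValue (infinitesimal_evalAt _) (infinitesimal_universalPoint N)
      (pderiv_evalAt_inl a) (pderiv_universalPoint ha)]

theorem RestrictsToAncestor.pderiv_pderiv {N : ℕ} {a b : ι × ℕ} (ha : a.2 < N) (hb : b.2 < N) :
    restrictVars (levelBelow N) (MvPowerSeries.pderiv K (Sum.inr b)
        (MvPowerSeries.pderiv K (Sum.inr a) G))
      = ancestorHessian g F (evalAt infinitesimal_X_inl) (universalPoint N) a b := by
  rw [← pderiv_restrictVars _ (show levelBelow N (Sum.inr b) from hb), hG.pderiv ha,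
    pderiv_ancestorMomentum (infinitesimal_evalAt _) (infinitesimal_universalPoint N)
      (pderiv_evalAt_inl b) (pderiv_universalPoint hb)]

theorem RestrictsToAncestor.pderiv_pderiv_pderiv {N : ℕ} {a b c : ι × ℕ} (ha : a.2 < N)
    (hb : b.2 < N) (hc : c.2 < N) :
    restrictVars (levelBelow N) (MvPowerSeries.pderiv K (Sum.inr c)
        (MvPowerSeries.pderiv K (Sum.inr b) (MvPowerSeries.pderiv K (Sum.inr a) G)))
      = ancestorThird g F (evalAt infinitesimal_X_inl) (universalPoint N) a b c := by
  rw [← pderiv_restrictVars _ (show levelBelow N (Sum.inr c) from hc), hG.pderiv_pderiv ha hb,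
    pderiv_ancestorHessian (infinitesimal_evalAt _) (infinitesimal_universalPoint N)
      (pderiv_evalAt_inl c) (pderiv_universalPoint hc)]

theorem RestrictsToAncestor.subst_eq {τ : ι → MvPowerSeries Y K} (hτ : Infinitesimal τ)
    {t : ι × ℕ →₀ MvPowerSeries Y K} (ht : Infinitesimal t) :
    subst (Sum.elim τ t) G = ancestorValue g i₀ F (evalAt hτ) t := by
  obtain ⟨N, hN⟩ := exists_forall_eq_zero t
  rw [← subst_elim_restrictVars hτ ht hN, hG N, ← substAlgHom_apply (R := K) (hasSubst_elim hτ ht),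
    map_ancestorValue _ _ (substAlgHom_subst_point _) (infinitesimal_evalAt _)
      (infinitesimal_universalPoint N), substAlgHom_comp_evalAt hτ ht,
    mapPoint_universalPoint_eq hτ ht hN]

theorem RestrictsToAncestor.subst_pderiv {τ : ι → MvPowerSeries Y K} (hτ : Infinitesimal τ)
    {t : ι × ℕ →₀ MvPowerSeries Y K} (ht : Infinitesimal t) (a : ι × ℕ) :
    subst (Sum.elim τ t) (MvPowerSeries.pderiv K (Sum.inr a) G)
      = ancestorMomentum g i₀ F (evalAt hτ) t a := by
  obtain ⟨N, hN⟩ := exists_forall_eq_zero t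
  -- The level must also exceed the index of `a`, so that t̄_a is a free variable there and can be
  -- differentiated.
  have hN' : ∀ α k, N + a.2 + 1 ≤ k → t (α, k) = 0 := fun α k hk => hN α k (by omega)
  rw [← subst_elim_restrictVars hτ ht hN', hG.pderiv (by omega),
    ← substAlgHom_apply (R := K) (hasSubst_elim hτ ht),
    map_ancestorMomentum _ _ (substAlgHom_subst_point _) (infinitesimal_evalAt _)
      (infinitesimal_universalPoint _), substAlgHom_comp_evalAt hτ ht,
    mapPoint_universalPoint_eq hτ ht hN']

end Restricts

/-! ### Loops as pairs of a position and a covector -/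

section Loops

variable {R : Type*} [CommRing R] [Algebra K R]

/-- Elements of H_- are arbitrary series in z⁻¹ and g is invertible, so every covector on H[z] is
represented. -/
theorem exists_isGraphPoint (hg : IsUnit g.det) (hsymm : g.IsSymm) (t : ι × ℕ →₀ R)
    (p : ι × ℕ → R) : ∃ f : Loop ι R, IsGraphPoint g i₀ f t p := by
  obtain ⟨L, hL⟩ := exists_forall_eq_zero (dilatonShift i₀ t)
  let P : ℕ → ι → R := fun k => (-1 : ℤ) ^ (k + 1) •
    (g⁻¹.map (algebraMap K R)).mulVec fun α => p (α, k)
  -- The index n is the exponent of z⁻¹: n ≤ 0 carries the position, and n = k + 1 the covector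
  -- component k.
  let c : ι → ℤ → R := fun α n =>
    if n ≤ 0 then dilatonShift i₀ t (α, (-n).toNat) else P (n - 1).toNat α
  let f : Loop ι R := fun α => HahnSeries.ofSuppBddBelow (c α) ⟨-(L : ℤ), by
    intro n hn
    by_contra h
    apply hn
    have : n ≤ 0 := by omega
    rw [show c α n = dilatonShift i₀ t (α, (-n).toNat) from if_pos this]
    exact hL _ _ (by omega)⟩
  have hf : ∀ n α, zCoeff f n α = c α (-n) := fun n α => rfl
  refine ⟨f, fun α k => ?_, fun α k => ?_⟩
  · rw [hf]
    simp [c]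
  · have h := congrFun (omega_zMonomial_mulVec hsymm f k) α
    refine h.trans ?_
    have hz : zCoeff f (-((k + 1 : ℕ) : ℤ)) = P k := by
      funext β
      rw [hf, neg_neg]
      have : ¬ (((k + 1 : ℕ) : ℤ) ≤ 0) := by omega
      simp only [c]
      rw [if_neg this]
      congr 1
      push_cast
      omega
    rw [hz, Matrix.mulVec_smul, Matrix.mulVec_mulVec, map_mul_inv_map hg, Matrix.one_mulVec,
      smul_smul, ← mul_pow]
    simp

theorem IsGraphPoint.unique (hg : IsUnit g.det) (hsymm : g.IsSymm) {t : ι × ℕ →₀ R}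
    {p : ι × ℕ → R} {f f' : Loop ι R} (hf : IsGraphPoint g i₀ f t p)
    (hf' : IsGraphPoint g i₀ f' t p) : f = f' := by
  have hmom : ∀ k, (fun α => Omega g f (zMonomial α k)) = fun α => Omega g f' (zMonomial α k) :=
    fun k => funext fun α => (hf.2 α k).trans (hf'.2 α k).symm
  funext α
  ext n
  rcases le_or_gt n 0 with hn | hn
  · obtain ⟨k, rfl⟩ := Int.exists_eq_neg_ofNat hn
    exact (hf.1 α k).trans (hf'.1 α k).symm
  · obtain ⟨k, rfl⟩ := Int.eq_succ_of_zero_lt hn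
    have h1 := zCoeff_neg_eq hg hsymm f k
    rw [hmom, ← zCoeff_neg_eq hg hsymm f' k] at h1
    have h2 := congrFun h1 α
    rw [zCoeff, zCoeff, neg_neg] at h2
    exact_mod_cast h2

theorem HasPosition.unique {f : Loop ι R} {t t' : ι × ℕ →₀ R} (h : HasPosition i₀ f t)
    (h' : HasPosition i₀ f t') : t = t' := by
  apply dilatonShift_injective (i₀ := i₀)
  ext ⟨α, k⟩
  exact (h α k).symm.trans (h' α k)

end Loops

theorem calibrationAt_calibration {Y : Type u} {τ : ι → MvPowerSeries Y K}
    (hτ : Infinitesimal τ) :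
    calibrationAt (calibration g F) τ = seriesMatrix (calibrationEval g F (evalAt hτ)) := by
  ext1 α β
  rw [calibrationAt, Matrix.map_apply, seriesMatrix, Matrix.of_apply]
  congr 2
  funext n
  rw [calibration, Matrix.of_apply, PowerSeries.coeff_mk, calibrationEval, Matrix.map_apply,
    evalAt, substAlgHom_apply]

/-- The position and momentum formulas send points of L to the graph of dF̄. Conversely a graph
point equals the image of the point of L over its descendant position, because position and covector
determine a loop. -/
theorem RestrictsToAncestor.isAncestorPotential (hg : IsUnit g.det) (hsymm : g.IsSymm)
    (hDE : DilatonEquation i₀ F) (hSE : StringEquation g i₀ F) (hTRR : TopologicalRecursion g F)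
    {G : MvPowerSeries (ι ⊕ ι × ℕ) K} (hG : RestrictsToAncestor g i₀ F G) :
    IsAncestorPotential g i₀ F (calibration g F) G := by
  have hpoint : ∀ (Y : Type u) (τ : ι → MvPowerSeries Y K) (hτ : Infinitesimal τ)
      (f : Loop ι (MvPowerSeries Y K)) (t : ι × ℕ →₀ MvPowerSeries Y K), Infinitesimal t →
      IsGraphPoint g i₀ f t (fun i => subst t (MvPowerSeries.pderiv K i F)) →
      IsGraphPoint g i₀ ((calibrationAt (calibration g F) τ).mulVec f)
        (ancestorPoint g F (evalAt hτ) t)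
        (ancestorMomentum g i₀ F (evalAt hτ) (ancestorPoint g F (evalAt hτ) t)) := by
    intro Y τ hτ f t ht hf
    rw [calibrationAt_calibration hτ]
    refine ⟨fun α k => ?_, fun α k => ?_⟩
    · rw [hf.1.seriesMatrix_mulVec, dilatonShift_ancestorPoint _ hg hsymm hSE]
    · rw [omega_seriesMatrix_mulVec _ hg hsymm hSE hTRR hf.1 (α, k), ancestorMomentum,
        descendantPoint_ancestorPoint _ hg hsymm hSE hTRR]
      have : (fun i : ι × ℕ => Omega g f (zMonomial i.1 i.2))
          = fun i => subst t (MvPowerSeries.pderiv K i F) := funext fun i => hf.2 i.1 i.2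
      rw [this]
  have hmom : ∀ (Y : Type u) (τ : ι → MvPowerSeries Y K) (hτ : Infinitesimal τ)
      (t : ι × ℕ →₀ MvPowerSeries Y K), Infinitesimal t →
      (fun i => subst (Sum.elim τ t) (MvPowerSeries.pderiv K (Sum.inr i) G))
        = ancestorMomentum g i₀ F (evalAt hτ) t :=
    fun Y τ hτ t ht => funext fun i => hG.subst_pderiv hτ ht i
  have hgraph : ∀ (Y : Type u) (τ : ι → MvPowerSeries Y K), Infinitesimal τ →
      translatedCone g i₀ F (calibration g F) τ = parametricGraph g i₀ G τ := by
    intro Y τ hτ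
    ext f
    constructor
    · rintro ⟨f, ⟨t, ht, hf⟩, rfl⟩
      have hinf := infinitesimal_ancestorPoint (g := g) (F := F) _ (infinitesimal_evalAt hτ) ht
      refine ⟨ancestorPoint g F (evalAt hτ) t, hinf, ?_⟩
      rw [hmom Y τ hτ _ hinf]
      exact hpoint Y τ hτ f t ht hf
    · rintro ⟨t, ht, hf⟩
      have hinf := infinitesimal_descendantPoint (g := g) (F := F) _ (infinitesimal_evalAt hτ) ht
      obtain ⟨f₀, hf₀⟩ := exists_isGraphPoint (i₀ := i₀) hg hsymm
        (descendantPoint g F (evalAt hτ) t)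
        (fun i => subst (descendantPoint g F (evalAt hτ) t) (MvPowerSeries.pderiv K i F))
      refine ⟨f₀, ⟨_, hinf, hf₀⟩, ?_⟩
      have h := hpoint Y τ hτ f₀ _ hinf hf₀
      rw [ancestorPoint_descendantPoint _ hg hsymm hSE hTRR] at h
      rw [hmom Y τ hτ t ht] at hf
      exact h.unique hg hsymm hf
  refine ⟨hgraph, fun Y τ hτ f hf t ht hpos => ?_⟩
  rw [hgraph Y τ hτ] at hf
  obtain ⟨t', ht', hf⟩ := hf
  obtain rfl := hpos.unique hf.1
  rw [hmom Y τ hτ t ht] at hf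
  have h := sum_mul_ancestorMomentum (evalAt hτ) hg hsymm hDE hSE (infinitesimal_evalAt hτ) ht
  rw [hG.subst_eq hτ ht, pairingPQ]
  simp only [fun i : ι × ℕ => hf.2 i.1 i.2]
  rw [h, smul_smul]
  norm_num

/-- The variables (τ, t̄) themselves serve as parameters. The graph condition puts a point of L_τ
over each universal position, and there p(q)/2 fixes the potential. -/
theorem IsAncestorPotential.unique (hg : IsUnit g.det) (hsymm : g.IsSymm)
    {S : Matrix ι ι (PowerSeries (MvPowerSeries ι K))} {G G' : MvPowerSeries (ι ⊕ ι × ℕ) K}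
    (hG : IsAncestorPotential g i₀ F S G) (hG' : IsAncestorPotential g i₀ F S G') : G = G' := by
  refine eq_of_restrictVars_eq exists_levelBelow 0 fun N _ => ?_
  have hinf : Infinitesimal (universalPoint N : ι × ℕ →₀ MvPowerSeries (ι ⊕ ι × ℕ) K) :=
    infinitesimal_universalPoint N
  obtain ⟨f, hf⟩ := exists_isGraphPoint (i₀ := i₀) hg hsymm
    (universalPoint N : ι × ℕ →₀ MvPowerSeries (ι ⊕ ι × ℕ) K)
    (fun i => subst (Sum.elim (fun α => X (Sum.inl α)) (universalPoint N))
      (MvPowerSeries.pderiv K (Sum.inr i) G))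
  have hmem : f ∈ translatedCone g i₀ F S
      (fun α => (X (Sum.inl α) : MvPowerSeries (ι ⊕ ι × ℕ) K)) := by
    rw [hG.graph _ _ infinitesimal_X_inl]
    exact ⟨_, hinf, hf⟩
  rw [restrictVars_levelBelow, restrictVars_levelBelow,
    hG.quadratic _ _ infinitesimal_X_inl f hmem _ hinf hf.1,
    hG'.quadratic _ _ infinitesimal_X_inl f hmem _ hinf hf.1]

end Ancestor

/-! ### Tameness -/

section Tame

variable {ι : Type*} [Fintype ι] [DecidableEq ι] {K : Type*} [CommRing K] [Algebra ℚ K]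

/-- The iterated derivative along the variables `t̄_i`, `i ∈ l`. -/
def iteratedPderiv (l : List (ι × ℕ)) (x : MvPowerSeries (ι ⊕ ι × ℕ) K) :
    MvPowerSeries (ι ⊕ ι × ℕ) K :=
  l.foldr (fun i x' => pderiv K (Sum.inr i) x') x

theorem iteratedPderiv_cons (i : ι × ℕ) (l : List (ι × ℕ)) (x : MvPowerSeries (ι ⊕ ι × ℕ) K) :
    iteratedPderiv (i :: l) x = iteratedPderiv l (pderiv K (Sum.inr i) x) := by
  induction l with
  | nil => rfl
  | cons j l ih =>
    change pderiv K (Sum.inr i) (pderiv K (Sum.inr j) (iteratedPderiv l x))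
      = pderiv K (Sum.inr j) (iteratedPderiv l (pderiv K (Sum.inr i) x))
    rw [← ih, pderiv_comm]
    rfl

theorem iteratedPderiv_perm {l l' : List (ι × ℕ)} (h : l.Perm l')
    (x : MvPowerSeries (ι ⊕ ι × ℕ) K) : iteratedPderiv l x = iteratedPderiv l' x := by
  have : LeftCommutative fun (i : ι × ℕ) (x' : MvPowerSeries (ι ⊕ ι × ℕ) K) =>
      pderiv K (Sum.inr i) x' := ⟨fun i j y => pderiv_comm _ _ y⟩
  exact h.foldr_eq x

theorem iteratedPderiv_sum {I : Type*} (l : List (ι × ℕ)) (s : Finset I)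
    (f : I → MvPowerSeries (ι ⊕ ι × ℕ) K) :
    iteratedPderiv l (∑ i ∈ s, f i) = ∑ i ∈ s, iteratedPderiv l (f i) := by
  induction l with
  | nil => rfl
  | cons j l ih =>
    change pderiv K (Sum.inr j) (iteratedPderiv l _) = _
    rw [ih, map_sum]
    rfl

theorem iteratedPderiv_add (l : List (ι × ℕ)) (x y : MvPowerSeries (ι ⊕ ι × ℕ) K) :
    iteratedPderiv l (x + y) = iteratedPderiv l x + iteratedPderiv l y := by
  induction l with
  | nil => rfl
  | cons j l ih =>
    change pderiv K (Sum.inr j) (iteratedPderiv l _) = _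
    rw [ih, map_add]
    rfl

theorem iteratedPderiv_smul (l : List (ι × ℕ)) (c : K) (x : MvPowerSeries (ι ⊕ ι × ℕ) K) :
    iteratedPderiv l (c • x) = c • iteratedPderiv l x := by
  induction l with
  | nil => rfl
  | cons j l ih =>
    change pderiv K (Sum.inr j) (iteratedPderiv l _) = _
    rw [ih, Derivation.map_smul]
    rfl

theorem infinitesimal_X : Infinitesimal fun α => (X α : MvPowerSeries ι K) :=
  fun _ => constantCoeff_X _

theorem infinitesimal_zero {Y : Type*} :
    Infinitesimal ((0 : ι × ℕ →₀ MvPowerSeries Y K) : ι × ℕ → MvPowerSeries Y K) :=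
  fun _ => map_zero _

/-- Restriction to `t̄ = 0` as an algebra homomorphism. -/
def originHom : MvPowerSeries (ι ⊕ ι × ℕ) K →ₐ[K] MvPowerSeries ι K :=
  substAlgHom (hasSubst_elim infinitesimal_X infinitesimal_zero)

theorem originHom_apply (x : MvPowerSeries (ι ⊕ ι × ℕ) K) : originHom x = atOrigin x :=
  substAlgHom_apply _ x

/-- The derivatives of order `l` with `∑ k ≤ M` and `∑ k > r + c` vanish at `t̄ = 0`. -/
def VanishesAbove (M : ℕ) (c : ℤ) (x : MvPowerSeries (ι ⊕ ι × ℕ) K) : Prop :=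
  ∀ l : List (ι × ℕ), (l.map Prod.snd).sum ≤ M →
    ((l.map Prod.snd).sum : ℤ) > (l.length : ℤ) + c → originHom (iteratedPderiv l x) = 0

theorem VanishesAbove.pderiv {M k : ℕ} {c : ℤ} {x : MvPowerSeries (ι ⊕ ι × ℕ) K}
    (hx : VanishesAbove (M + k) c x) (α : ι) :
    VanishesAbove M (c + 1 - k) (pderiv K (Sum.inr (α, k)) x) := by
  intro l hM hl
  rw [← iteratedPderiv_cons]
  apply hx
  · simp only [List.map_cons, List.sum_cons]
    omega
  · simp only [List.map_cons, List.sum_cons, List.length_cons]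
    omega

theorem VanishesAbove.mono {M M' : ℕ} {c : ℤ} {x : MvPowerSeries (ι ⊕ ι × ℕ) K}
    (hx : VanishesAbove M c x) (h : M' ≤ M) : VanishesAbove M' c x :=
  fun l hM hl => hx l (hM.trans h) hl

/-- By Leibniz the indices are distributed between the factors. If their total exceeds r + c + d,
then one factor exceeds its own bound. -/
theorem VanishesAbove.mul {M : ℕ} {c d : ℤ} {x y : MvPowerSeries (ι ⊕ ι × ℕ) K}
    (hx : VanishesAbove M c x) (hy : VanishesAbove M d y) : VanishesAbove M (c + d) (x * y) := by
  intro l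
  induction l generalizing M c d x y with
  | nil =>
    intro _ h
    change originHom (x * y) = 0
    rw [map_mul]
    simp only [List.map_nil, List.sum_nil, List.length_nil] at h
    -- With no derivatives left, 0 > c + d forces one of the two constants to be negative.
    rcases lt_or_ge c 0 with hc | hc
    · have : originHom x = 0 := hx [] (Nat.zero_le _) (by simpa using hc)
      rw [this, zero_mul]
    · have : originHom y = 0 := hy [] (Nat.zero_le _) (by simp; push_cast at h; omega)
      rw [this, mul_zero]
  | cons i l ih =>
    intro hM h
    obtain ⟨α, k⟩ := i
    simp only [List.map_cons, List.sum_cons, List.length_cons] at hM h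
    obtain ⟨M', rfl⟩ := Nat.exists_eq_add_of_le' (show k ≤ M by omega)
    rw [iteratedPderiv_cons, Derivation.leibniz, smul_eq_mul, smul_eq_mul, iteratedPderiv_add,
      map_add, ih (hx.mono (Nat.le_add_right M' k)) (hy.pderiv α) (by omega) (by omega),
      ih (hy.mono (Nat.le_add_right M' k)) (hx.pderiv α) (by omega) (by omega), add_zero]

theorem VanishesAbove.smul {M : ℕ} {c : ℤ} {x : MvPowerSeries (ι ⊕ ι × ℕ) K}
    (hx : VanishesAbove M c x) (a : K) : VanishesAbove M c (a • x) := by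
  intro l hM hl
  rw [iteratedPderiv_smul, map_smul, hx l hM hl, smul_zero]

theorem VanishesAbove.sum {I : Type*} {M : ℕ} {c : ℤ} {s : Finset I}
    {f : I → MvPowerSeries (ι ⊕ ι × ℕ) K} (hf : ∀ i ∈ s, VanishesAbove M c (f i)) :
    VanishesAbove M c (∑ i ∈ s, f i) := by
  intro l hM hl
  rw [iteratedPderiv_sum, map_sum]
  exact Finset.sum_eq_zero fun i hi => hf i hi l hM hl

/-- Topological recursion and the vanishing of the 2-jet at `t̄ = 0` imply tameness. -/
theorem isTame_of_recursion (g : Matrix ι ι K) {G : MvPowerSeries (ι ⊕ ι × ℕ) K}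
    (hrec : ∀ (α : ι) (k : ℕ) (b c : ι × ℕ),
      pderiv K (Sum.inr c) (pderiv K (Sum.inr b) (pderiv K (Sum.inr (α, k + 1)) G))
        = ∑ μ, ∑ ν, g⁻¹ μ ν • (pderiv K (Sum.inr (μ, 0)) (pderiv K (Sum.inr (α, k)) G)
          * pderiv K (Sum.inr c) (pderiv K (Sum.inr b) (pderiv K (Sum.inr (ν, 0)) G))))
    (h0 : atOrigin G = 0) (h1 : ∀ a, atOrigin (pderiv K (Sum.inr a) G) = 0)
    (h2 : ∀ a b, atOrigin (pderiv K (Sum.inr b) (pderiv K (Sum.inr a) G)) = 0) : IsTame G := by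
  have key : ∀ M, VanishesAbove M (-3) G := by
    intro M
    induction M with
    | zero =>
      intro l hM hl
      -- When all indices are zero the inequality forces r < 3, so the vanishing of the 2-jet
      -- suffices.
      have hlen : l.length < 3 := by omega
      match l, hlen with
      | [], _ => exact (originHom_apply G).trans h0
      | [a], _ => exact (originHom_apply _).trans (h1 a)
      | [a, b], _ => exact (originHom_apply _).trans (h2 b a)
    | succ M ih =>
      intro l hM hl
      by_cases hlen : l.length < 3
      · match l, hlen with
        | [], _ => exact (originHom_apply G).trans h0
        | [a], _ => exact (originHom_apply _).trans (h1 a)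
        | [a, b], _ => exact (originHom_apply _).trans (h2 b a)
      -- For r ≥ 3 the sum of the indices is positive, so some index can be lowered by recursion; it
      -- is moved to the front.
      have hex : ∃ a ∈ l, 0 < a.2 := by
        by_contra! hcon
        have : (l.map Prod.snd).sum = 0 := by
          rw [List.sum_eq_zero_iff]
          intro n hn
          obtain ⟨a, ha, rfl⟩ := List.mem_map.mp hn
          exact Nat.le_zero.mp (hcon a ha)
        omega
      obtain ⟨⟨α, k'⟩, hal, hk⟩ := hex
      obtain ⟨k, rfl⟩ := Nat.exists_eq_succ_of_ne_zero (Nat.pos_iff_ne_zero.mp hk)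
      have hperm := List.perm_cons_erase hal
      have hlength := hperm.length_eq
      have hsum := (hperm.map Prod.snd).sum_eq
      rw [iteratedPderiv_perm hperm]
      generalize l.erase (α, k.succ) = l' at hlength hsum
      match l' with
      | [] => simp at hlength; omega
      | [_] => simp at hlength; omega
      | (β, b) :: (γ, c) :: r =>
        simp only [List.map_cons, List.sum_cons, List.length_cons] at hsum hlength
        rw [iteratedPderiv_cons, iteratedPderiv_cons, iteratedPderiv_cons, Nat.succ_eq_add_one,
          hrec]
        -- TRR replaces k + 1 by k, so both factors fall under the induction hypothesis. Their
        -- constants are -1 - k and -b - c, whose sum is exactly the bound left for the remaining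
        -- indices `r`.
        obtain ⟨M', hM'⟩ := Nat.exists_eq_add_of_le' (show k + b + c ≤ M by omega)
        have hx : ∀ μ, VanishesAbove M' (-3 + 1 - (k : ℕ) + 1 - (0 : ℕ))
            (pderiv K (Sum.inr (μ, 0)) (pderiv K (Sum.inr (α, k)) G)) := fun μ =>
          VanishesAbove.pderiv (VanishesAbove.pderiv (ih.mono (by omega)) α) μ
        have hy : ∀ ν, VanishesAbove M' (-3 + 1 - (0 : ℕ) + 1 - (b : ℕ) + 1 - (c : ℕ))
            (pderiv K (Sum.inr (γ, c)) (pderiv K (Sum.inr (β, b))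
              (pderiv K (Sum.inr (ν, 0)) G))) := fun ν =>
          VanishesAbove.pderiv (VanishesAbove.pderiv (VanishesAbove.pderiv
            (ih.mono (by omega)) ν) β) γ
        refine VanishesAbove.sum (fun μ _ => VanishesAbove.sum fun ν _ =>
          ((hx μ).mul (hy ν)).smul (g⁻¹ μ ν)) r (by omega) ?_
        omega
  intro l hl
  rw [← originHom_apply]
  exact key _ l le_rfl (by omega)

end Tame

/-! ### Vanishing of the 2-jet at the origin, and tameness -/

section Main

variable {ι : Type u} [Fintype ι] [DecidableEq ι] {K : Type v} [CommRing K] [Algebra ℚ K]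
  {g : Matrix ι ι K} {i₀ : ι} {F : MvPowerSeries (ι × ℕ) K}

section Origin

variable {Y : Type*} {τ : ι → MvPowerSeries Y K} (hτ : Infinitesimal τ)

theorem descendantPoint_zero : descendantPoint g F (evalAt hτ) 0 = basePoint (evalAt hτ) := by
  rw [descendantPoint, map_zero, zero_add]

/-- At t̄ = 0 the descendant point is τ, where ∂∂F equals W(τ). -/
theorem ancestorHessian_origin (a b : ι × ℕ) :
    ancestorHessian g F (evalAt hτ) 0 a b = 0 := by
  rw [ancestorHessian]
  refine Finset.sum_eq_zero fun i _ => ?_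
  beta_reduce
  rw [Finsupp.sum, Finset.sum_eq_zero, mul_zero]
  intro j _
  rw [descendantPoint_zero, subst_basePoint, smallHessian_comm, smallHessian, sub_self, mul_zero]

/-- Degree 1 homogeneity of the gradient gives p = W(τ)q at t = τ, so the reduced momentum vanishes.
-/
theorem ancestorMomentum_origin (hDE : DilatonEquation i₀ F) (a : ι × ℕ) :
    ancestorMomentum g i₀ F (evalAt hτ) 0 a = 0 := by
  rw [ancestorMomentum]
  refine Finset.sum_eq_zero fun i _ => ?_
  have hinf := infinitesimal_descendantPoint (g := g) (F := F) _ (infinitesimal_evalAt hτ)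
    infinitesimal_zero
  have h := hDE.sum_mul_subst_pderiv_pderiv hinf i
  beta_reduce
  rw [reducedMomentum, ← h]
  simp only [descendantPoint_zero, subst_basePoint, smallHessian_comm F i]
  simp only [smallHessian, sub_self, mul_zero]

theorem ancestorValue_origin (hg : IsUnit g.det) (hsymm : g.IsSymm) (hDE : DilatonEquation i₀ F)
    (hSE : StringEquation g i₀ F) : ancestorValue g i₀ F (evalAt hτ) 0 = 0 := by
  have h := sum_mul_ancestorMomentum (evalAt hτ) hg hsymm hDE hSE (infinitesimal_evalAt hτ)
    (infinitesimal_zero (ι := ι))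
  simp only [ancestorMomentum_origin hτ hDE, zero_mul, Finsupp.sum_fun_zero] at h
  have h2 := congrArg (fun x => (1 / 2 : ℚ) • x) h
  rw [smul_zero, smul_smul] at h2
  norm_num at h2
  exact h2.symm

end Origin

theorem RestrictsToAncestor.atOrigin_pderiv_pderiv {G : MvPowerSeries (ι ⊕ ι × ℕ) K}
    (hG : RestrictsToAncestor g i₀ F G) (a b : ι × ℕ) :
    atOrigin (MvPowerSeries.pderiv K (Sum.inr b) (MvPowerSeries.pderiv K (Sum.inr a) G)) = 0 := by
  have hX : Infinitesimal fun α => (X α : MvPowerSeries ι K) := infinitesimal_X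
  have h0 : Infinitesimal ((0 : ι × ℕ →₀ MvPowerSeries ι K) : ι × ℕ → MvPowerSeries ι K) :=
    infinitesimal_zero
  let N := a.2 + b.2 + 1
  have hN : ∀ α k, N ≤ k → (0 : ι × ℕ →₀ MvPowerSeries ι K) (α, k) = 0 := fun _ _ _ => rfl
  have hu : Infinitesimal (universalPoint N : ι × ℕ →₀ MvPowerSeries (ι ⊕ ι × ℕ) K) :=
    infinitesimal_universalPoint N
  have hinf := infinitesimal_descendantPoint (g := g) (F := F) _
    (infinitesimal_evalAt infinitesimal_X_inl) hu
  change subst (Sum.elim _ ((0 : ι × ℕ →₀ MvPowerSeries ι K) : ι × ℕ → MvPowerSeries ι K)) _ = 0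
  rw [← subst_elim_restrictVars hX h0 hN, hG.pderiv_pderiv (by omega) (by omega),
    ← substAlgHom_apply (R := K) (hasSubst_elim hX h0),
    ← ancestorHessian_origin hX a b (g := g) (F := F),
    map_ancestorHessian _ _ (substAlgHom_subst_point _) (infinitesimal_evalAt _) hu,
    substAlgHom_comp_evalAt hX h0, mapPoint_universalPoint_eq hX h0 hN]

theorem RestrictsToAncestor.isTame (hg : IsUnit g.det) (hsymm : g.IsSymm)
    (hDE : DilatonEquation i₀ F) (hSE : StringEquation g i₀ F) (hTRR : TopologicalRecursion g F)
    {G : MvPowerSeries (ι ⊕ ι × ℕ) K} (hG : RestrictsToAncestor g i₀ F G) : IsTame G := by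
  have hX : Infinitesimal fun α => (X α : MvPowerSeries ι K) := infinitesimal_X
  refine isTame_of_recursion g (fun α k b c => ?_) ?_ (fun a => ?_) hG.atOrigin_pderiv_pderiv
  -- The recursion is checked at levels exceeding k + 1 and the indices of b and c, where all the
  -- variables involved are free.
  · refine eq_of_restrictVars_eq exists_levelBelow (k + b.2 + c.2 + 2) fun N hN => ?_
    rw [hG.pderiv_pderiv_pderiv (by dsimp only; omega) (by omega) (by omega),
      ancestorThird_succ hg hsymm hSE hTRR (infinitesimal_descendantPoint _
        (infinitesimal_evalAt _) (infinitesimal_universalPoint N)), map_sum]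
    refine Finset.sum_congr rfl fun μ _ => ?_
    rw [map_sum]
    refine Finset.sum_congr rfl fun ν _ => ?_
    rw [restrictVars_eq_subst, ← substAlgHom_apply (R := K) (hasSubst_restrict _), map_smul,
      map_mul, substAlgHom_apply, substAlgHom_apply, ← restrictVars_eq_subst,
      ← restrictVars_eq_subst, hG.pderiv_pderiv (by dsimp only; omega) (by dsimp only; omega),
      hG.pderiv_pderiv_pderiv (by dsimp only; omega) (by omega) (by omega)]
  · exact (hG.subst_eq hX infinitesimal_zero).trans (ancestorValue_origin hX hg hsymm hDE hSE)
  · exact (hG.subst_pderiv hX infinitesimal_zero a).trans (ancestorMomentum_origin hX hDE a)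

end Main

end GenusZero

end

theorem mainTheorem3 {ι : Type u} [Fintype ι] [DecidableEq ι] {K : Type v} [CommRing K]
    [Algebra ℚ K] (g : Matrix ι ι K) (hsymm : g.IsSymm) (hnondeg : IsUnit g.det) (i₀ : ι)
    (F : MvPowerSeries (ι × ℕ) K)
    (hDE : GenusZero.DilatonEquation i₀ F)
    (hSE : GenusZero.StringEquation g i₀ F)
    (hTRR : GenusZero.TopologicalRecursion g F) :
    (∃! S : Matrix ι ι (PowerSeries (MvPowerSeries ι K)), GenusZero.IsCalibration g i₀ F S) ∧
    ∀ S : Matrix ι ι (PowerSeries (MvPowerSeries ι K)), GenusZero.IsCalibration g i₀ F S →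
      (∃! G : MvPowerSeries (ι ⊕ ι × ℕ) K, GenusZero.IsAncestorPotential g i₀ F S G) ∧
      ∀ G : MvPowerSeries (ι ⊕ ι × ℕ) K, GenusZero.IsAncestorPotential g i₀ F S G →
        GenusZero.IsTame G := by
  have hS₀ := GenusZero.isCalibration_calibration hnondeg hsymm hSE hTRR
  refine ⟨⟨_, hS₀, fun S hS => hS.unique hnondeg hsymm hSE hS₀⟩, fun S hS => ?_⟩
  -- Any calibration is the explicit one, for which the ancestor potential has been constructed.
  obtain rfl := hS.unique hnondeg hsymm hSE hS₀
  obtain ⟨G₀, hG₀⟩ := GenusZero.exists_restrictsToAncestor g i₀ F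
  have hA := hG₀.isAncestorPotential hnondeg hsymm hDE hSE hTRR
  refine ⟨⟨G₀, hA, fun G hG => hG.unique hnondeg hsymm hA⟩, fun G hG => ?_⟩
  rw [hG.unique hnondeg hsymm hA]
  exact hG₀.isTame hnondeg hsymm hDE hSE hTRR
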